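/- Let $\alpha,\beta,\epsilon>0$, $\mathbb{T}=\mathbb{R}/2\pi\mathbb{Z}$ and $\langle x\rangle=(1+x^2)^{1/2}$. For $f\in C_c^\infty(\mathbb{T}\times\mathbb{R})$ (complex-valued) put $$\widehat f(k,\tau)=\frac1{4\pi^2}\int_{\mathbb{R}}\int_{\mathbb{T}}f(x,t)e^{-i(kx+\tau t)}\,dx\,dt,\qquad k\in\mathbb{Z},\ \tau\in\mathbb{R},$$ and for $s,l,b\in\mathbb{R}$ let $$\|f\|_{X^{s,b}_S}=\big\|\langle k\rangle^{s}\langle\tau+\alpha k^2+\epsilon^2k^4\rangle^{b}\widehat f(k,\tau)\big\|_{\ell^2_kL^2_\tau},\qquad \|f\|_{X^{l,b}_W}=\big\|\langle k\rangle^{l}\langle|\tau|-\beta|k|\langle\epsilon k\rangle\rangle^{b}\widehat f(k,\tau)\big\|_{\ell^2_kL^2_\tau}.$$ The Bourgain spaces $X^{s,b}_S$, $X^{l,b}_W$ are the completions of $C_c^\infty(\mathbb{T}\times\mathbb{R})$ for these norms, that is, the spaces of those $f$ whose space-time Fourier transform $\widehat f$ is a measurable function on $\mathbb{Z}\times\mathbb{R}$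 for which the norm is finite. $D^\rho$ is the Fourier multiplier with symbol $|k|^\rho$. **Proposition.** Let $0<\rho\le1$, $s\ge0$, $-1\le l\le 2s+1-\rho$, $-2+\rho\le s-l\le2$ and $b\in(\frac16,\frac12]$. Then there exists $C=C(\alpha,\beta,\epsilon,\rho,s,l,b)>0$ such that $$\|un\|_{X^{s,-1/2}_S}\le C\big(\|u\|_{X^{s,b}_S}\|n\|_{X^{l,1/2}_W}+\|u\|_{X^{s,1/2}_S}\|n\|_{X^{l,b}_W}\big),$$ $$\|D^\rho(u\overline v)\|_{X^{l,-1/2}_W}\le C\big(\|u\|_{X^{s,b}_S}\|v\|_{X^{s,1/2}_S}+\|u\|_{X^{s,1/2}_S}\|v\|_{X^{s,b}_S}\big)$$ for all $u,v,n\in C_c^\infty(\mathbb{T}\times\mathbb{R})$ and, more generally, for all $u,v\in X^{s,1/2}_S$ and $n\in X^{l,1/2}_W$. In the general case the products are defined through the convolutions $\widehat{un}=\widehat u*\widehat n$ and $\widehat{u\overline v}=\widehat u*\widehat{\overline v}$ on $\mathbb{Z}\times\mathbb{R}$, where $\widehat{\overline v}(k,\tau)=\overline{\widehat v(-k,-\tau)}$;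 these converge absolutely for every $k$ and almost every $\tau$, and $un\in X^{s,-1/2}_S$, $D^\rho(u\overline v)\in X^{l,-1/2}_W$. -/

import Mathlib

open scoped ENNReal ComplexConjugate
open MeasureTheory

noncomputable section

namespace QZS

/-- The Japanese bracket `⟨x⟩ = (1 + x²)^{1/2}`. -/
def jap (x : ℝ) : ℝ := Real.sqrt (1 + x ^ 2)

/-- Smooth compactly supported functions on `𝕋 × ℝ`, `𝕋 = ℝ / 2πℤ`, written as functions of `(x, t)`
that are smooth, `2π`-periodic in `x` and vanish for large `|t|`. -/
structure IsTest (f : ℝ × ℝ → ℂ) : Prop where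
  smooth : ContDiff ℝ ((⊤ : ℕ∞) : WithTop ℕ∞) f
  periodic : ∀ x t : ℝ, f (x + 2 * Real.pi, t) = f (x, t)
  support : ∃ R : ℝ, ∀ x t : ℝ, R < |t| → f (x, t) = 0

/-- The space-time Fourier transform
`f̂(k, τ) = (4π²)⁻¹ ∫_ℝ ∫_𝕋 f(x, t) e^{-i(kx + τt)} dx dt`. -/
def ft (f : ℝ × ℝ → ℂ) (k : ℤ) (τ : ℝ) : ℂ :=
  (1 / (4 * (Real.pi : ℂ) ^ 2)) *
    ∫ t : ℝ, ∫ x in (0 : ℝ)..(2 * Real.pi),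
      f (x, t) * Complex.exp (-Complex.I * ((k : ℂ) * (x : ℂ) + (τ : ℂ) * (t : ℂ)))

/-- `τ + α k² + ε² k⁴`. -/
def phaseS (α ε : ℝ) (k : ℤ) (τ : ℝ) : ℝ := τ + α * (k : ℝ) ^ 2 + ε ^ 2 * (k : ℝ) ^ 4

/-- `|τ| - β |k| ⟨ε k⟩`. -/
def phaseW (β ε : ℝ) (k : ℤ) (τ : ℝ) : ℝ := |τ| - β * |(k : ℝ)| * jap (ε * (k : ℝ))

/-- The `ℓ²_k L²_τ` norm of `⟨k⟩^s ⟨φ(k, τ)⟩^b F(k, τ)`, with values in `[0, ∞]`. -/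
def weightedNorm (φ : ℤ → ℝ → ℝ) (s b : ℝ) (F : ℤ → ℝ → ℂ) : ℝ≥0∞ :=
  (∑' k : ℤ, ∫⁻ τ : ℝ,
    ENNReal.ofReal (jap (k : ℝ) ^ s * jap (φ k τ) ^ b * ‖F k τ‖) ^ 2) ^ (1 / 2 : ℝ)

/-- The norm of `X^{s,b}_S` in terms of the space-time Fourier transform `F`. -/
def normS (α ε s b : ℝ) (F : ℤ → ℝ → ℂ) : ℝ≥0∞ := weightedNorm (phaseS α ε) s b F

/-- The norm of `X^{l,b}_W` in terms of the space-time Fourier transform `F`. -/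
def normW (β ε l b : ℝ) (F : ℤ → ℝ → ℂ) : ℝ≥0∞ := weightedNorm (phaseW β ε) l b F

/-- `F` is the space-time Fourier transform of an element of `X^{s,b}_S`. The weight is continuous
and, with its inverse, of polynomial growth in `τ`, so this weighted `L²` space is the completion of
the smooth compactly supported functions for the norm `normS`. -/
def MemXS (α ε s b : ℝ) (F : ℤ → ℝ → ℂ) : Prop :=
  (∀ k, AEStronglyMeasurable (F k) volume) ∧ normS α ε s b F < ∞

/-- `F` is the space-time Fourier transform of an element of `X^{l,b}_W`. -/
def MemXW (β ε l b : ℝ) (F : ℤ → ℝ → ℂ) : Prop :=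
  (∀ k, AEStronglyMeasurable (F k) volume) ∧ normW β ε l b F < ∞

/-- The convolution of two functions on `ℤ × ℝ` converges absolutely at `(k, τ)`. -/
def ConvAbs (F G : ℤ → ℝ → ℂ) (k : ℤ) (τ : ℝ) : Prop :=
  ∑' k₁ : ℤ, ∫⁻ τ₁ : ℝ, ‖F k₁ τ₁‖ₑ * ‖G (k - k₁) (τ - τ₁)‖ₑ < ∞

/-- Convolution on `ℤ × ℝ`, the Fourier transform of a product. -/
def conv (F G : ℤ → ℝ → ℂ) (k : ℤ) (τ : ℝ) : ℂ :=
  ∑' k₁ : ℤ, ∫ τ₁ : ℝ, F k₁ τ₁ * G (k - k₁) (τ - τ₁)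

/-- The Fourier transform of the complex conjugate. -/
def conjFT (F : ℤ → ℝ → ℂ) (k : ℤ) (τ : ℝ) : ℂ := conj (F (-k) (-τ))

/-- `D^ρ`, the Fourier multiplier `|k|^ρ`, on the Fourier side. -/
def mulD (ρ : ℝ) (F : ℤ → ℝ → ℂ) (k : ℤ) (τ : ℝ) : ℂ := ((|(k : ℝ)| ^ ρ : ℝ) : ℂ) * F k τ

end QZS

end

/-!
The estimates are proved on the Fourier side, on the group `ℤ × ℝ`, for the absolute values.

*Resonance.* For Schrödinger waves at `(k, τ)` and `(k₁, τ₁)` and the acoustic wave at their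
difference, the time frequencies cancel in a suitable combination of the three modulations, and
what remains is `|k - k₁| |k + k₁| (α + ε² (k² + k₁²)) - β |k - k₁| ⟨ε (k - k₁)⟩` up to signs
(`abs_resonance_le_modSum`). Hence the sum of the modulations is at least a constant times
`⟨k - k₁⟩²` in all cases, and a constant times the fourth power of the larger frequency when one of
`k`, `k₁` is at least twice the other. The conditions on `s`, `l`, `ρ` make the frequency
multipliers of the two estimates bounded by a multiple of the square root of that sum
(`exists_schrodinger_multiplier_le`, `exists_wave_multiplier_le`).

*Kernels.* After the largest modulation has been cancelled, Cauchy–Schwarz reduces each estimate to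
bounds, uniform in one of the three variables, for integrals of `m₁^{-2b} m₂^{-1}` over the
frequency group, where `m₁` and `m₂` are the other two modulations. The time integral gives a
negative power `γ > 1/3` of a polynomial phase in one integer variable; this is where `b > 1/6`
enters. For two Schrödinger modulations with distinct spatial frequencies the phase is a cubic
with separated values. For a Schrödinger and a wave modulation it is, up to a bounded error, a
quartic with fixed leading coefficients, and second divided differences bound the number of
integers where it is small (`exists_lintegral_modS_modS_le`, `exists_lintegral_modS_modW_le`).
Two equal spatial frequencies, where the cubic degenerates, do no harm: in the first estimate no
gain is needed there, and in the second the symbol of `D^ρ` vanishes.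

*Test functions.* Their Fourier transforms decay rapidly, so they lie in all the spaces, and the
Fourier inversion formula turns products into convolutions (`IsTest.ft_mul`).
-/

namespace QZS

/-! ### The Japanese bracket -/

lemma one_le_jap (x : ℝ) : 1 ≤ jap x := by
  rw [jap, Real.one_le_sqrt]; nlinarith [sq_nonneg x]

lemma jap_pos (x : ℝ) : 0 < jap x := one_pos.trans_le (one_le_jap x)

lemma jap_sq (x : ℝ) : jap x ^ 2 = 1 + x ^ 2 := Real.sq_sqrt (by positivity)

lemma abs_le_jap (x : ℝ) : |x| ≤ jap x := by
  apply abs_le_of_sq_le_sq _ (jap_pos x).le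
  rw [jap_sq]; linarith

lemma jap_le_one_add_abs (x : ℝ) : jap x ≤ 1 + |x| := by
  rw [jap, Real.sqrt_le_left (by positivity)]
  nlinarith [sq_abs x, abs_nonneg x]

@[simp] lemma jap_neg (x : ℝ) : jap (-x) = jap x := by simp [jap]

@[simp] lemma jap_zero : jap 0 = 1 := by simp [jap]

lemma jap_add_le (x y : ℝ) : jap (x + y) ≤ jap x + jap y := by
  refine (pow_le_pow_iff_left₀ (jap_pos _).le (add_pos (jap_pos x) (jap_pos y)).le two_ne_zero).1 ?_
  have h : |x| * |y| ≤ jap x * jap y :=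
    mul_le_mul (abs_le_jap x) (abs_le_jap y) (abs_nonneg y) (jap_pos x).le
  nlinarith [jap_sq x, jap_sq y, jap_sq (x + y), le_abs_self (x * y), abs_mul x y]

lemma jap_le_of_abs_le {x y c : ℝ} (hc : 1 ≤ c) (h : |x| ≤ c * |y|) : jap x ≤ c * jap y := by
  refine (pow_le_pow_iff_left₀ (jap_pos _).le (mul_nonneg (by linarith) (jap_pos y).le)
    two_ne_zero).1 ?_
  have h2 : |x| ^ 2 ≤ (c * |y|) ^ 2 := pow_le_pow_left₀ (abs_nonneg x) h 2
  rw [mul_pow, jap_sq, jap_sq]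
  rw [mul_pow, sq_abs, sq_abs] at h2
  nlinarith

lemma continuous_jap : Continuous jap := by unfold jap; fun_prop

@[fun_prop]
lemma measurable_jap : Measurable jap := continuous_jap.measurable

lemma jap_rpow (x r : ℝ) : jap x ^ r = (1 + ‖x‖ ^ 2) ^ (r / 2) := by
  rw [jap, Real.sqrt_eq_rpow, ← Real.rpow_mul (by positivity), Real.norm_eq_abs, sq_abs]
  congr 1; ring

lemma integrable_jap_rpow {r : ℝ} (hr : 1 < r) : Integrable (fun x => jap x ^ (-r)) := by
  have h := integrable_rpow_neg_one_add_norm_sq (E := ℝ) (μ := volume) (r := r)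
    (by simpa using hr)
  refine h.congr (.of_forall fun x => ?_)
  simp only [jap_rpow]

lemma summable_jap_rpow {r : ℝ} (hr : 1 < r) : Summable (fun n : ℤ => jap n ^ (-r)) := by
  have h0 : Summable (fun n : ℤ => if n = 0 then (1 : ℝ) else 0) :=
    summable_of_ne_finset_zero (s := {0}) (by simp)
  refine Summable.of_nonneg_of_le (fun n => Real.rpow_nonneg (jap_pos _).le _) (fun n => ?_)
    ((Real.summable_abs_int_rpow hr).add h0)
  by_cases hn : n = 0
  · subst hn
    simp [Real.zero_rpow (show -r ≠ 0 by linarith)]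
  · have : 0 < |(n : ℝ)| := by positivity
    simp only [hn, if_false, add_zero]
    exact Real.rpow_le_rpow_of_nonpos this (abs_le_jap _) (by linarith)

/-- Interpolation between two brackets: a product of negative powers of `⟨x⟩` and `⟨y⟩` controls a
negative power of `⟨x + y⟩`, and what is left over goes to one of the two factors. Applied with
`p + q - γ > 1`, it makes the `τ`-integral of the product decay like `⟨x + y⟩^{-γ}`. -/
lemma jap_rpow_mul_le {p q γ : ℝ} (hγ : 0 ≤ γ) (hp : γ ≤ p) (hq : γ ≤ q) (x y : ℝ) :
    jap x ^ (-p) * jap y ^ (-q) ≤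
      2 ^ γ * jap (x + y) ^ (-γ) * (jap x ^ (-(p + q - γ)) + jap y ^ (-(p + q - γ))) := by
  have key : ∀ {p q x y : ℝ}, γ ≤ q → jap x ≤ jap y →
      jap x ^ (-p) * jap y ^ (-q) ≤ 2 ^ γ * jap (x + y) ^ (-γ) * jap x ^ (-(p + q - γ)) := by
    intro p q x y hq hxy
    have hX := jap_pos x
    have hY := jap_pos y
    have hZ := jap_pos (x + y)
    have h1 : jap y ^ (-γ) ≤ 2 ^ γ * jap (x + y) ^ (-γ) := by
      have h := Real.rpow_le_rpow_of_nonpos (z := -γ) (show 0 < jap (x + y) / 2 by linarith)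
        (show jap (x + y) / 2 ≤ jap y by linarith [jap_add_le x y]) (by linarith)
      rw [Real.div_rpow hZ.le zero_le_two, Real.rpow_neg zero_le_two, div_inv_eq_mul] at h
      linarith
    have h2 : jap y ^ (-(q - γ)) ≤ jap x ^ (-(q - γ)) :=
      Real.rpow_le_rpow_of_nonpos hX hxy (by linarith)
    calc jap x ^ (-p) * jap y ^ (-q)
        = jap x ^ (-p) * (jap y ^ (-γ) * jap y ^ (-(q - γ))) := by
          rw [← Real.rpow_add hY]; ring_nf
      _ ≤ jap x ^ (-p) * ((2 ^ γ * jap (x + y) ^ (-γ)) * jap x ^ (-(q - γ))) := by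
          gcongr
      _ = 2 ^ γ * jap (x + y) ^ (-γ) * (jap x ^ (-p) * jap x ^ (-(q - γ))) := by ring
      _ = _ := by rw [← Real.rpow_add hX]; ring_nf
  have hA : 0 ≤ 2 ^ γ * jap (x + y) ^ (-γ) :=
    mul_nonneg (by positivity) (Real.rpow_nonneg (jap_pos _).le _)
  rcases le_total (jap x) (jap y) with h | h
  · refine (key hq h).trans (mul_le_mul_of_nonneg_left ?_ hA)
    linarith [Real.rpow_nonneg (jap_pos y).le (-(p + q - γ))]
  · have := key (p := q) hp h
    rw [mul_comm, add_comm x y, add_comm p q]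
    refine this.trans (mul_le_mul_of_nonneg_left ?_ (by rwa [add_comm x y] at hA))
    linarith [Real.rpow_nonneg (jap_pos x).le (-(q + p - γ))]

/-! ### Counting lemmas for polynomial phases -/

/-- If on every finite set each value `⟨h x⟩` dominates the cube of the bracket of `x - a₁`,
`x - a₂` or `x - a₃`, for three integers `aᵢ` that may depend on the set, then
`∑ ⟨h x⟩^{-γ}` is bounded for `γ > 1/3`, uniformly over all such `h`. -/
lemma exists_sum_jap_rpow_le {γ c : ℝ} (hγ : 1 / 3 < γ) (hc : 0 < c) :
    ∃ C : ℝ, 0 < C ∧ ∀ (h : ℤ → ℝ) (F : Finset ℤ),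
      (∃ a₁ a₂ a₃ : ℤ, ∀ x ∈ F, c * jap ((x - a₁ : ℤ) : ℝ) ^ 3 ≤ jap (h x) ∨
        c * jap ((x - a₂ : ℤ) : ℝ) ^ 3 ≤ jap (h x) ∨
        c * jap ((x - a₃ : ℤ) : ℝ) ^ 3 ≤ jap (h x)) →
      ∑ x ∈ F, jap (h x) ^ (-γ) ≤ C := by
  have hS := summable_jap_rpow (r := 3 * γ) (by linarith)
  set S := ∑' n : ℤ, jap (n : ℝ) ^ (-(3 * γ)) with hSdef
  have hnn : ∀ x : ℝ, 0 ≤ jap x ^ (-(3 * γ)) := fun x => Real.rpow_nonneg (jap_pos x).le _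
  have hSnn : 0 ≤ S := tsum_nonneg fun n => hnn n
  refine ⟨c ^ (-γ) * (3 * S) + 1, by positivity, fun h F ⟨a₁, a₂, a₃, hF⟩ => ?_⟩
  have hshift : ∀ a : ℤ, ∑ x ∈ F, jap ((x - a : ℤ) : ℝ) ^ (-(3 * γ)) ≤ S := by
    intro a
    have h1 : Summable (fun x : ℤ => jap ((x - a : ℤ) : ℝ) ^ (-(3 * γ))) :=
      (Equiv.subRight a).summable_iff.2 hS
    calc _ ≤ ∑' x : ℤ, jap ((x - a : ℤ) : ℝ) ^ (-(3 * γ)) :=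
          h1.sum_le_tsum F fun i _ => hnn _
      _ = S := (Equiv.subRight a).tsum_eq (fun n : ℤ => jap (n : ℝ) ^ (-(3 * γ)))
  have hone : ∀ x a : ℤ, c * jap ((x - a : ℤ) : ℝ) ^ 3 ≤ jap (h x) →
      jap (h x) ^ (-γ) ≤ c ^ (-γ) * jap ((x - a : ℤ) : ℝ) ^ (-(3 * γ)) := by
    intro x a hx
    have hp := jap_pos ((x - a : ℤ) : ℝ)
    have h1 := Real.rpow_le_rpow_of_nonpos (z := -γ) (by positivity) hx (by linarith)
    rw [Real.mul_rpow hc.le (by positivity), ← Real.rpow_natCast, ← Real.rpow_mul hp.le] at h1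
    convert h1 using 3
    push_cast; ring
  calc ∑ x ∈ F, jap (h x) ^ (-γ)
      ≤ ∑ x ∈ F, c ^ (-γ) * (jap ((x - a₁ : ℤ) : ℝ) ^ (-(3 * γ)) +
          jap ((x - a₂ : ℤ) : ℝ) ^ (-(3 * γ)) + jap ((x - a₃ : ℤ) : ℝ) ^ (-(3 * γ))) := by
        refine Finset.sum_le_sum fun x hx => ?_
        have hcp : 0 < c ^ (-γ) := Real.rpow_pos_of_pos hc _
        rcases hF x hx with h' | h' | h' <;> refine (hone x _ h').trans ?_ <;>
          refine mul_le_mul_of_nonneg_left ?_ hcp.le <;>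
          linarith [hnn ((x - a₁ : ℤ) : ℝ), hnn ((x - a₂ : ℤ) : ℝ), hnn ((x - a₃ : ℤ) : ℝ)]
    _ ≤ c ^ (-γ) * (3 * S) := by
        rw [← Finset.mul_sum, Finset.sum_add_distrib, Finset.sum_add_distrib]
        refine mul_le_mul_of_nonneg_left ?_ (Real.rpow_nonneg hc.le _)
        linarith [hshift a₁, hshift a₂, hshift a₃]
    _ ≤ _ := by linarith

/-- Cubic separation suffices for the counting bound: compare every point with a minimizer
of `|h|`. -/
lemma exists_sum_jap_rpow_le_of_separated {γ c : ℝ} (hγ : 1 / 3 < γ) (hc : 0 < c) :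
    ∃ C : ℝ, 0 < C ∧ ∀ (h : ℤ → ℝ) (F : Finset ℤ),
      (∀ x y : ℤ, c * |(x : ℝ) - y| ^ 3 ≤ |h x - h y|) →
      ∑ x ∈ F, jap (h x) ^ (-γ) ≤ C := by
  have hd : 0 < min (1 / 8) (c / 16) := by positivity
  obtain ⟨C, hC, H⟩ := exists_sum_jap_rpow_le hγ hd
  refine ⟨C, hC, fun h F hh => ?_⟩
  rcases F.eq_empty_or_nonempty with rfl | hF
  · simpa using hC.le
  obtain ⟨a, ha, hmin⟩ := F.exists_min_image (fun x => |h x|) hF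
  refine H h F ⟨a, a, a, fun x hx => Or.inl ?_⟩
  have h1 : c * |(x : ℝ) - a| ^ 3 ≤ 2 * jap (h x) :=
    calc _ ≤ |h x - h a| := hh x a
      _ ≤ |h x| + |h a| := abs_sub _ _
      _ ≤ 2 * |h x| := by linarith [hmin x hx]
      _ ≤ _ := by linarith [abs_le_jap (h x)]
  push_cast
  rcases eq_or_ne x a with rfl | hne
  · rw [sub_self, jap_zero]
    nlinarith [min_le_left (1 / 8 : ℝ) (c / 16), one_le_jap (h x)]
  · have hge : 1 ≤ |(x : ℝ) - a| := by
      have := Int.one_le_abs (sub_ne_zero.2 hne)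
      exact_mod_cast this
    have h2 : jap ((x : ℝ) - a) ≤ 2 * |(x : ℝ) - a| := by
      linarith [jap_le_one_add_abs ((x : ℝ) - a)]
    calc min (1 / 8) (c / 16) * jap ((x : ℝ) - a) ^ 3
        ≤ (c / 16) * (2 * |(x : ℝ) - a|) ^ 3 :=
          mul_le_mul (min_le_right _ _) (pow_le_pow_left₀ (jap_pos _).le h2 3)
            (pow_nonneg (jap_pos _).le 3) (by positivity)
      _ = (c * |(x : ℝ) - a| ^ 3) / 2 := by ring
      _ ≤ jap (h x) := by linarith

/-- Eliminating the distances `p`, `q`, `r` between three points from the bound for a second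
divided difference: what remains is the smallest distance `t`. -/
lemma le_of_three_distances {E L p q r t : ℝ} (hE : 0 ≤ E) (hr : 1 ≤ r) (ht : 1 ≤ t)
    (htp : t ≤ p) (htq : t ≤ q) (h : E / 4 * (p * q * r) ≤ L * (r + q + p)) : E / 12 * t ≤ L := by
  have hp : 0 ≤ p := by linarith
  have hq : 0 ≤ q := by linarith
  have hpq : 0 ≤ p * q := mul_nonneg hp hq
  have e1 : t * r ≤ p * q * r := by
    have h1 : t * 1 ≤ p * q := mul_le_mul htp (ht.trans htq) zero_le_one hp
    rw [mul_one] at h1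
    exact mul_le_mul_of_nonneg_right h1 (by linarith)
  have e2 : p * q ≤ p * q * r := le_mul_of_one_le_right hpq hr
  have e3 : t * q ≤ p * q := mul_le_mul_of_nonneg_right htp hq
  have e4 : t * p ≤ q * p := mul_le_mul_of_nonneg_right htq hp
  have hb1 : t * (r + q + p) ≤ 3 * (p * q * r) := by linarith
  have hpos : 0 < r + q + p := by linarith
  refine le_of_mul_le_mul_right ?_ hpos
  calc E / 12 * t * (r + q + p) = E / 12 * (t * (r + q + p)) := by ring
    _ ≤ E / 12 * (3 * (p * q * r)) := mul_le_mul_of_nonneg_left hb1 (by positivity)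
    _ = E / 4 * (p * q * r) := by ring
    _ ≤ _ := h

/-- A quartic with fixed leading and quadratic coefficients, no cubic term and arbitrary lower
order terms: its second divided difference at `a`, `b`, `x` is at least `e x² / 4` for `|x|` large.
If `a` and `b` are the two points of a finite set where `|h|` is smallest, all the values of `h`
in that difference are at most `|h x|`, which forces `|h x|` to be large
compared with `x² min (|x - a|, |x - b|)`. -/
lemma exists_sum_jap_rpow_le_of_quartic {γ e A : ℝ} (hγ : 1 / 3 < γ) (he : 0 < e) :
    ∃ C : ℝ, 0 < C ∧ ∀ (B D : ℝ) (F : Finset ℤ),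
      ∑ x ∈ F, jap (e * (x : ℝ) ^ 4 + A * (x : ℝ) ^ 2 + B * x + D) ^ (-γ) ≤ C := by
  set M : ℝ := 1 + 4 * |A| / e with hM
  have hM1 : 1 ≤ M := by rw [hM]; linarith [show 0 ≤ 4 * |A| / e by positivity]
  have hMA : 4 * |A| ≤ e * M := by
    rw [hM]; field_simp; linarith
  have hd : 0 < min (1 / (8 * M ^ 3)) (e / 96) := by positivity
  obtain ⟨C, hC, H⟩ := exists_sum_jap_rpow_le hγ hd
  refine ⟨C, hC, fun B D F => ?_⟩
  set h : ℤ → ℝ := fun x => e * (x : ℝ) ^ 4 + A * (x : ℝ) ^ 2 + B * x + D with hh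
  -- the two smallest values, with arbitrary choices when there are fewer than two points
  obtain ⟨a, b, hab⟩ : ∃ a b : ℤ, ∀ x ∈ F, x = a ∨ x = b ∨
      (a ≠ b ∧ |h a| ≤ |h x| ∧ |h b| ≤ |h x|) := by
    rcases F.eq_empty_or_nonempty with rfl | hF
    · exact ⟨0, 0, by simp⟩
    obtain ⟨a, ha, hmin⟩ := F.exists_min_image (fun x => |h x|) hF
    rcases (F.erase a).eq_empty_or_nonempty with hE | hE
    · refine ⟨a, a, fun x hx => Or.inl ?_⟩
      by_contra hne
      have := Finset.mem_erase.2 ⟨hne, hx⟩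
      simp [hE] at this
    obtain ⟨b, hb, hminb⟩ := (F.erase a).exists_min_image (fun x => |h x|) hE
    refine ⟨a, b, fun x hx => ?_⟩
    by_cases hxa : x = a
    · exact Or.inl hxa
    exact Or.inr (Or.inr ⟨(Finset.ne_of_mem_erase hb).symm, hmin x hx,
      hminb x (Finset.mem_erase.2 ⟨hxa, hx⟩)⟩)
  refine H h F ⟨0, a, b, fun x hx => ?_⟩
  have hm1 := min_le_left (1 / (8 * M ^ 3)) (e / 96)
  have hm2 := min_le_right (1 / (8 * M ^ 3)) (e / 96)
  have hm3 : min (1 / (8 * M ^ 3)) (e / 96) ≤ 1 := by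
    refine hm1.trans ((div_le_one (by positivity)).2 ?_)
    linarith [one_le_pow₀ hM1 (n := 3)]
  push_cast
  rcases hab x hx with rfl | rfl | ⟨hne, hha, hhb⟩
  · refine Or.inr (Or.inl ?_)
    rw [sub_self, jap_zero]; linarith [one_le_jap (h x)]
  · refine Or.inr (Or.inr ?_)
    rw [sub_self, jap_zero]; linarith [one_le_jap (h x)]
  by_cases hxa : x = a
  · refine Or.inr (Or.inl ?_)
    rw [hxa, sub_self, jap_zero]; linarith [one_le_jap (h a)]
  by_cases hxb : x = b
  · refine Or.inr (Or.inr ?_)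
    rw [hxb, sub_self, jap_zero]; linarith [one_le_jap (h b)]
  have hint : ∀ {m n : ℤ}, m ≠ n → 1 ≤ |(m : ℝ) - n| := fun {m n} hmn => by
    exact_mod_cast Int.one_le_abs (sub_ne_zero.2 hmn)
  rcases lt_or_ge |(x : ℝ)| M with hxM | hxM
  · refine Or.inl ?_
    rw [sub_zero]
    have h1 : jap x ≤ 2 * M := by linarith [jap_le_one_add_abs (x : ℝ)]
    calc _ ≤ (1 / (8 * M ^ 3)) * (2 * M) ^ 3 :=
          mul_le_mul hm1 (pow_le_pow_left₀ (jap_pos _).le h1 3)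
            (pow_nonneg (jap_pos _).le 3) (by positivity)
      _ = 1 := by field_simp; norm_num
      _ ≤ _ := one_le_jap _
  -- the divided difference
  have hquad : e * (x : ℝ) ^ 2 / 4 ≤
      e * ((x : ℝ) ^ 2 + a ^ 2 + b ^ 2 + x * a + a * b + b * x) + A := by
    have h1 : (x : ℝ) ^ 2 / 2 ≤ (x : ℝ) ^ 2 + a ^ 2 + b ^ 2 + x * a + a * b + b * x := by
      nlinarith [sq_nonneg ((x : ℝ) + a + b), sq_nonneg (a : ℝ), sq_nonneg (b : ℝ)]
    have h2 : |A| ≤ e * (x : ℝ) ^ 2 / 4 := by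
      have : M ≤ (x : ℝ) ^ 2 := by rw [← sq_abs]; nlinarith
      nlinarith
    have h3 := neg_abs_le A
    nlinarith
  have hid : (e * ((x : ℝ) ^ 2 + a ^ 2 + b ^ 2 + x * a + a * b + b * x) + A) *
      (((x : ℝ) - a) * ((x : ℝ) - b) * ((a : ℝ) - b)) =
      h x * ((a : ℝ) - b) - h a * ((x : ℝ) - b) + h b * ((x : ℝ) - a) := by
    simp only [hh]; ring
  have h1ab := hint hne
  have h1xa := hint hxa
  have h1xb := hint hxb
  set p := |(x : ℝ) - a| with hp
  set q := |(x : ℝ) - b| with hq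
  set r := |(a : ℝ) - b| with hr
  have hle : e * (x : ℝ) ^ 2 / 4 * (p * q * r) ≤ |h x| * (r + q + p) := by
    have hpqr : 0 ≤ p * q * r := by positivity
    calc e * (x : ℝ) ^ 2 / 4 * (p * q * r) ≤
        |e * ((x : ℝ) ^ 2 + a ^ 2 + b ^ 2 + x * a + a * b + b * x) + A| * (p * q * r) :=
          mul_le_mul_of_nonneg_right (hquad.trans (le_abs_self _)) hpqr
      _ = |h x * ((a : ℝ) - b) - h a * ((x : ℝ) - b) + h b * ((x : ℝ) - a)| := by
          rw [← hid, abs_mul, abs_mul, abs_mul]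
      _ ≤ |h x| * r + |h a| * q + |h b| * p := by
          refine (abs_add_le _ _).trans (add_le_add ((abs_sub _ _).trans ?_) ?_) <;>
            simp only [abs_mul, le_refl, hp, hq, hr]
      _ ≤ |h x| * r + |h x| * q + |h x| * p := by gcongr
      _ = _ := by ring
  have hmain : ∀ t : ℝ, 1 ≤ t → t ≤ p → t ≤ q → e * (x : ℝ) ^ 2 / 12 * t ≤ |h x| :=
    fun t ht htp htq => le_of_three_distances (by positivity) h1ab ht htp htq hle
  -- conclude with the smallest of `|x|`, `p`, `q`
  have hfin : ∀ (t : ℝ), 1 ≤ |t| → |t| ≤ |(x : ℝ)| → |t| ≤ p → |t| ≤ q →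
      min (1 / (8 * M ^ 3)) (e / 96) * jap t ^ 3 ≤ jap (h x) := by
    intro t ht h1 h2 h3
    have hjt : jap t ≤ 2 * |t| := by linarith [jap_le_one_add_abs t]
    have hsq : |t| ^ 2 ≤ (x : ℝ) ^ 2 := by rw [← sq_abs (x : ℝ)]; gcongr
    calc _ ≤ (e / 96) * (2 * |t|) ^ 3 :=
          mul_le_mul hm2 (pow_le_pow_left₀ (jap_pos _).le hjt 3)
            (pow_nonneg (jap_pos _).le 3) (by positivity)
      _ = e * |t| ^ 2 / 12 * |t| := by ring
      _ ≤ e * (x : ℝ) ^ 2 / 12 * |t| := by gcongr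
      _ ≤ |h x| := hmain _ ht h2 h3
      _ ≤ _ := abs_le_jap _
  have hx1 : 1 ≤ |(x : ℝ)| := hM1.trans hxM
  rcases le_total |(x : ℝ)| p with c1 | c1 <;> rcases le_total p q with c2 | c2
  · exact Or.inl (by rw [sub_zero]; exact hfin x hx1 le_rfl c1 (c1.trans c2))
  · rcases le_total |(x : ℝ)| q with c3 | c3
    · exact Or.inl (by rw [sub_zero]; exact hfin x hx1 le_rfl c1 c3)
    · exact Or.inr (Or.inr (hfin _ h1xb c3 c2 le_rfl))
  · exact Or.inr (Or.inl (hfin _ h1xa c1 le_rfl c2))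
  · exact Or.inr (Or.inr (hfin _ h1xb (c2.trans c1) c2 le_rfl))

/-! ### Resonance -/

@[simp] lemma phaseW_neg (β ε : ℝ) (k : ℤ) (τ : ℝ) : phaseW β ε (-k) (-τ) = phaseW β ε k τ := by
  simp [phaseW]

lemma mul_sq_le_waveFreq {β ε : ℝ} (hβ : 0 < β) (hε : 0 < ε) (y : ℝ) :
    β * ε * y ^ 2 ≤ β * |y| * jap (ε * y) := by
  have h1 : ε * |y| ≤ jap (ε * y) := by
    rw [← abs_of_pos hε, ← abs_mul, abs_of_pos hε]; exact abs_le_jap _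
  calc β * ε * y ^ 2 = β * |y| * (ε * |y|) := by rw [← sq_abs]; ring
    _ ≤ _ := by gcongr

lemma waveFreq_le {β ε : ℝ} (hβ : 0 < β) (hε : 0 < ε) (y : ℝ) :
    β * |y| * jap (ε * y) ≤ β * ε * y ^ 2 + β / (2 * ε) := by
  have h1 : |ε * y| * jap (ε * y) ≤ (ε * y) ^ 2 + 1 / 2 := by
    refine (pow_le_pow_iff_left₀ (mul_nonneg (abs_nonneg _) (jap_pos _).le) (by positivity)
      two_ne_zero).1 ?_
    rw [mul_pow, jap_sq, sq_abs]; nlinarith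
  rw [abs_mul, abs_of_pos hε] at h1
  calc β * |y| * jap (ε * y) = β / ε * (ε * |y| * jap (ε * y)) := by field_simp
    _ ≤ β / ε * ((ε * y) ^ 2 + 1 / 2) := by gcongr
    _ = _ := by field_simp

/-- The sum of the three modulations of an interaction: Schrödinger waves at `(k, τ)` and
`(k₁, τ₁)`, and the acoustic wave at their difference. -/
noncomputable def modSum (α β ε : ℝ) (k k₁ : ℤ) (τ τ₁ : ℝ) : ℝ :=
  jap (phaseS α ε k τ) + jap (phaseS α ε k₁ τ₁) + jap (phaseW β ε (k - k₁) (τ - τ₁))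

lemma modSum_swap (α β ε : ℝ) (k k₁ : ℤ) (τ τ₁ : ℝ) :
    modSum α β ε k₁ k τ₁ τ = modSum α β ε k k₁ τ τ₁ := by
  unfold modSum
  rw [← phaseW_neg β ε (k - k₁), neg_sub, neg_sub]; ring

lemma one_le_modSum (α β ε : ℝ) (k k₁ : ℤ) (τ τ₁ : ℝ) : 1 ≤ modSum α β ε k k₁ τ τ₁ := by
  unfold modSum
  linarith [one_le_jap (phaseS α ε k τ), one_le_jap (phaseS α ε k₁ τ₁),
    one_le_jap (phaseW β ε (k - k₁) (τ - τ₁))]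

/-- The time frequencies cancel, so the modulations control the resonance function. -/
lemma abs_resonance_le_modSum (α β ε : ℝ) (k k₁ : ℤ) (τ τ₁ : ℝ) :
    |(|((k : ℝ) - k₁) * (k + k₁) * (α + ε ^ 2 * ((k : ℝ) ^ 2 + (k₁ : ℝ) ^ 2))| -
      β * |(k : ℝ) - k₁| * jap (ε * ((k : ℝ) - k₁)))| ≤ modSum α β ε k k₁ τ τ₁ := by
  have e1 := abs_le_jap (phaseS α ε k τ)
  have e2 := abs_le_jap (phaseS α ε k₁ τ₁)
  have e3 := abs_le_jap (phaseW β ε (k - k₁) (τ - τ₁))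
  have hid : ((k : ℝ) - k₁) * (k + k₁) * (α + ε ^ 2 * ((k : ℝ) ^ 2 + (k₁ : ℝ) ^ 2)) =
      phaseS α ε k τ - phaseS α ε k₁ τ₁ - (τ - τ₁) := by
    unfold phaseS; ring
  have hW : phaseW β ε (k - k₁) (τ - τ₁) =
      |τ - τ₁| - β * |(k : ℝ) - k₁| * jap (ε * ((k : ℝ) - k₁)) := by
    unfold phaseW; push_cast; ring
  unfold modSum
  rw [hid]
  set X := phaseS α ε k τ
  set Y := phaseS α ε k₁ τ₁
  set W := phaseW β ε (k - k₁) (τ - τ₁)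
  have h1 : |(|X - Y - (τ - τ₁)| - |τ - τ₁|)| ≤ |X| + |Y| := by
    have h := abs_abs_sub_abs_le (X - Y - (τ - τ₁)) (-(τ - τ₁))
    rw [abs_neg, sub_neg_eq_add, sub_add_cancel] at h
    exact h.trans (abs_sub _ _)
  have h2 : |X - Y - (τ - τ₁)| - β * |(k : ℝ) - k₁| * jap (ε * ((k : ℝ) - k₁)) =
      (|X - Y - (τ - τ₁)| - |τ - τ₁|) + W := by rw [hW]; ring
  rw [h2]
  exact (abs_add_le _ _).trans (by linarith)

lemma exists_jap_sq_le_modSum {α β ε : ℝ} (hα : 0 < α) (hβ : 0 < β) (hε : 0 < ε) :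
    ∃ C : ℝ, 0 < C ∧ ∀ (k k₁ : ℤ) (τ τ₁ : ℝ),
      jap ((k : ℝ) - k₁) ^ 2 ≤ C * modSum α β ε k k₁ τ τ₁ := by
  set T := 2 * (β * ε + 1) / ε ^ 2 with hT
  have hTpos : 0 < T := by positivity
  set D := β / (2 * ε) + (β * ε + 1) * T ^ 2 with hD
  have hDpos : 0 < D := by positivity
  refine ⟨1 / (β * ε) + D + 2, by positivity, fun k k₁ τ τ₁ => ?_⟩
  have hres := abs_resonance_le_modSum α β ε k k₁ τ τ₁
  have hS1 := one_le_modSum α β ε k k₁ τ τ₁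
  set S := modSum α β ε k k₁ τ τ₁
  have hω1 := mul_sq_le_waveFreq hβ hε ((k : ℝ) - k₁)
  have hω2 := waveFreq_le hβ hε ((k : ℝ) - k₁)
  set ω := β * |(k : ℝ) - k₁| * jap (ε * ((k : ℝ) - k₁))
  rw [abs_le] at hres
  rw [jap_sq]
  by_cases hk : k + k₁ = 0
  · have hk' : (k : ℝ) + k₁ = 0 := by exact_mod_cast hk
    rw [hk', mul_zero, zero_mul, abs_zero] at hres
    have h1 : β * ε * ((k : ℝ) - k₁) ^ 2 ≤ S := by linarith [hres.1]
    have h2 : ((k : ℝ) - k₁) ^ 2 ≤ 1 / (β * ε) * S := by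
      rw [one_div, ← div_eq_inv_mul, le_div_iff₀ (by positivity)]; linarith
    nlinarith
  · have hk' : 1 ≤ |(k : ℝ) + k₁| := by exact_mod_cast Int.one_le_abs hk
    set y := |(k : ℝ) - k₁| with hy
    have hy0 : 0 ≤ y := abs_nonneg _
    have hysq : y ^ 2 = ((k : ℝ) - k₁) ^ 2 := sq_abs _
    have h1 : ε ^ 2 / 2 * y ^ 3 ≤
        |((k : ℝ) - k₁) * (k + k₁) * (α + ε ^ 2 * ((k : ℝ) ^ 2 + (k₁ : ℝ) ^ 2))| := by
      have hp : 0 < α + ε ^ 2 * ((k : ℝ) ^ 2 + (k₁ : ℝ) ^ 2) := by positivity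
      rw [abs_mul, abs_mul, abs_of_pos hp, ← hy]
      calc ε ^ 2 / 2 * y ^ 3 = y * 1 * (ε ^ 2 * (y ^ 2 / 2)) := by ring
        _ ≤ y * |(k : ℝ) + k₁| * (α + ε ^ 2 * ((k : ℝ) ^ 2 + (k₁ : ℝ) ^ 2)) := by
          have h3 : y ^ 2 / 2 ≤ (k : ℝ) ^ 2 + (k₁ : ℝ) ^ 2 := by
            rw [hysq]; nlinarith [sq_nonneg ((k : ℝ) + k₁)]
          have h4 : ε ^ 2 * (y ^ 2 / 2) ≤ ε ^ 2 * ((k : ℝ) ^ 2 + (k₁ : ℝ) ^ 2) := by gcongr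
          refine mul_le_mul (by gcongr) (by linarith) (by positivity) (by positivity)
    -- the cubic term absorbs the quadratic one beyond `y = T`
    have h2 : (β * ε + 1) * y ^ 2 ≤ ε ^ 2 / 2 * y ^ 3 + (β * ε + 1) * T ^ 2 := by
      rcases le_total y T with h | h
      · have : (β * ε + 1) * y ^ 2 ≤ (β * ε + 1) * T ^ 2 := by gcongr
        have : 0 ≤ ε ^ 2 / 2 * y ^ 3 := by positivity
        linarith
      · have h5 : β * ε + 1 = ε ^ 2 / 2 * T := by rw [hT]; field_simp
        have : (β * ε + 1) * y ^ 2 ≤ ε ^ 2 / 2 * y ^ 3 := by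
          rw [h5]
          calc ε ^ 2 / 2 * T * y ^ 2 ≤ ε ^ 2 / 2 * y * y ^ 2 := by gcongr
            _ = _ := by ring
        have : 0 ≤ (β * ε + 1) * T ^ 2 := by positivity
        linarith
    have h3 : ((k : ℝ) - k₁) ^ 2 ≤ S + D := by
      rw [← hysq] at hω2 ⊢
      rw [hD]; nlinarith [hres.2]
    have h4 : 0 ≤ 1 / (β * ε) * S := by positivity
    nlinarith

lemma exists_jap_pow_four_le_modSum {α β ε : ℝ} (hα : 0 < α) (hβ : 0 < β) (hε : 0 < ε) :
    ∃ C : ℝ, 0 < C ∧ ∀ (k k₁ : ℤ) (τ τ₁ : ℝ), 2 * |(k₁ : ℝ)| ≤ |(k : ℝ)| →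
      jap (k : ℝ) ^ 4 ≤ C * modSum α β ε k k₁ τ τ₁ := by
  set a := 9 / 4 * (β * ε) with ha
  have hapos : 0 < a := by positivity
  set D := β / (2 * ε) + 2 * a ^ 2 / ε ^ 2 with hD
  have hDpos : 0 < D := by positivity
  refine ⟨16 / ε ^ 2 * (1 + D) + 2, by positivity, fun k k₁ τ τ₁ hk => ?_⟩
  have hres := abs_resonance_le_modSum α β ε k k₁ τ τ₁
  have hS1 := one_le_modSum α β ε k k₁ τ τ₁
  set S := modSum α β ε k k₁ τ τ₁
  have hω2 := waveFreq_le hβ hε ((k : ℝ) - k₁)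
  set ω := β * |(k : ℝ) - k₁| * jap (ε * ((k : ℝ) - k₁))
  rw [abs_le] at hres
  set x := |(k : ℝ)| with hx
  have hx0 : 0 ≤ x := abs_nonneg _
  have hxsq : x ^ 2 = (k : ℝ) ^ 2 := sq_abs _
  have hd : x / 2 ≤ |(k : ℝ) - k₁| := by linarith [abs_sub_abs_le_abs_sub (k : ℝ) k₁]
  have hd' : |(k : ℝ) - k₁| ≤ 3 / 2 * x := by linarith [abs_sub (k : ℝ) k₁]
  have hs : x / 2 ≤ |(k : ℝ) + k₁| := by
    have := abs_sub_abs_le_abs_sub (k : ℝ) (-k₁)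
    rw [abs_neg, sub_neg_eq_add] at this; linarith
  have h1 : ε ^ 2 / 4 * x ^ 4 ≤
      |((k : ℝ) - k₁) * (k + k₁) * (α + ε ^ 2 * ((k : ℝ) ^ 2 + (k₁ : ℝ) ^ 2))| := by
    have hp : 0 < α + ε ^ 2 * ((k : ℝ) ^ 2 + (k₁ : ℝ) ^ 2) := by positivity
    rw [abs_mul, abs_mul, abs_of_pos hp]
    calc ε ^ 2 / 4 * x ^ 4 = x / 2 * (x / 2) * (ε ^ 2 * x ^ 2) := by ring
      _ ≤ |(k : ℝ) - k₁| * |(k : ℝ) + k₁| * (α + ε ^ 2 * ((k : ℝ) ^ 2 + (k₁ : ℝ) ^ 2)) := by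
        refine mul_le_mul (by gcongr) ?_ (by positivity) (by positivity)
        rw [hxsq]; nlinarith [mul_nonneg (sq_nonneg ε) (sq_nonneg (k₁ : ℝ))]
  have h2 : ω ≤ a * x ^ 2 + β / (2 * ε) := by
    have : ((k : ℝ) - k₁) ^ 2 ≤ (3 / 2 * x) ^ 2 := by
      rw [← sq_abs]; gcongr
    have h3 : β * ε * ((k : ℝ) - k₁) ^ 2 ≤ β * ε * (3 / 2 * x) ^ 2 := by gcongr
    rw [ha]; linarith
  have h3 : a * x ^ 2 ≤ ε ^ 2 / 8 * x ^ 4 + 2 * a ^ 2 / ε ^ 2 := by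
    have : ε ^ 2 / 8 * x ^ 4 + 2 * a ^ 2 / ε ^ 2 - a * x ^ 2 =
        (ε ^ 2 * x ^ 2 - 4 * a) ^ 2 / (8 * ε ^ 2) := by field_simp; ring
    linarith [show 0 ≤ (ε ^ 2 * x ^ 2 - 4 * a) ^ 2 / (8 * ε ^ 2) by positivity]
  have h4 : ε ^ 2 / 8 * x ^ 4 ≤ S + D := by rw [hD]; linarith [hres.2]
  have h5 : 2 * x ^ 4 ≤ 16 / ε ^ 2 * (S + D) := by
    calc 2 * x ^ 4 = 16 / ε ^ 2 * (ε ^ 2 / 8 * x ^ 4) := by field_simp; ring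
      _ ≤ _ := by gcongr
  have h6 : jap (k : ℝ) ^ 4 ≤ 2 + 2 * x ^ 4 := by
    calc jap (k : ℝ) ^ 4 = (jap (k : ℝ) ^ 2) ^ 2 := by ring
      _ = (1 + x ^ 2) ^ 2 := by rw [jap_sq, hxsq]
      _ ≤ _ := by nlinarith [sq_nonneg (x ^ 2 - 1)]
  have h7 : 16 / ε ^ 2 * (S + D) ≤ 16 / ε ^ 2 * (1 + D) * S := by
    rw [mul_assoc]; gcongr; nlinarith
  nlinarith

/-! ### Bounds for the frequency multipliers -/

lemma rpow_le_two_rpow_mul {X Y a : ℝ} (hX : 0 ≤ X) (hY : 0 < Y) (h1 : X ≤ 2 * Y)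
    (h2 : Y ≤ 2 * X) : X ^ a ≤ 2 ^ |a| * Y ^ a := by
  rcases le_total 0 a with ha | ha
  · rw [abs_of_nonneg ha, ← Real.mul_rpow zero_le_two hY.le]
    exact Real.rpow_le_rpow hX h1 ha
  · have h := Real.rpow_le_rpow_of_nonpos (z := a) (show 0 < Y / 2 by linarith)
      (show Y / 2 ≤ X by linarith) ha
    rw [Real.div_rpow hY.le zero_le_two] at h
    rw [abs_of_nonpos ha, Real.rpow_neg zero_le_two]
    calc X ^ a ≤ _ := h
      _ = _ := by rw [div_eq_inv_mul]

lemma le_rpow_half_of_sq_le {x y : ℝ} (h : x ^ 2 ≤ y) : x ≤ y ^ (1 / 2 : ℝ) := by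
  rw [← Real.sqrt_eq_rpow]; exact Real.le_sqrt_of_sq_le h

lemma jap_sub_comparable {k k₁ : ℝ} (h : 2 * |k₁| ≤ |k|) :
    jap (k - k₁) ≤ 2 * jap k ∧ jap k ≤ 2 * jap (k - k₁) := by
  constructor <;> refine jap_le_of_abs_le one_le_two ?_
  · linarith [abs_sub k k₁, abs_nonneg k]
  · linarith [abs_sub_abs_le_abs_sub k k₁]

/-- The multiplier of the Schrödinger estimate gains half a power of the modulations. -/
lemma exists_schrodinger_multiplier_le {α β ε s l : ℝ} (hα : 0 < α) (hβ : 0 < β) (hε : 0 < ε)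
    (hs : 0 ≤ s) (hl : -1 ≤ l) (hsl : s - l ≤ 2) :
    ∃ C : ℝ, 0 < C ∧ ∀ (k k₁ : ℤ) (τ τ₁ : ℝ),
      jap (k : ℝ) ^ s * jap (k₁ : ℝ) ^ (-s) * jap ((k : ℝ) - k₁) ^ (-l) ≤
        C * modSum α β ε k k₁ τ τ₁ ^ (1 / 2 : ℝ) := by
  obtain ⟨C₁, hC₁, H₁⟩ := exists_jap_sq_le_modSum hα hβ hε
  obtain ⟨C₂, hC₂, H₂⟩ := exists_jap_pow_four_le_modSum hα hβ hε
  refine ⟨2 ^ s * C₁ ^ (1 / 2 : ℝ) + 2 ^ |(-l)| * C₂ ^ (1 / 2 : ℝ), by positivity,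
    fun k k₁ τ τ₁ => ?_⟩
  have hS := one_le_modSum α β ε k k₁ τ τ₁
  have hSp : 0 ≤ modSum α β ε k k₁ τ τ₁ ^ (1 / 2 : ℝ) := by positivity
  have hk := jap_pos (k : ℝ)
  have hk₁ := jap_pos (k₁ : ℝ)
  have hd := jap_pos ((k : ℝ) - k₁)
  rw [add_mul]
  rcases le_total |(k : ℝ)| (2 * |(k₁ : ℝ)|) with h | h
  · have h1 : jap (k : ℝ) ^ s ≤ 2 ^ s * jap (k₁ : ℝ) ^ s := by
      rw [← Real.mul_rpow zero_le_two hk₁.le]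
      exact Real.rpow_le_rpow hk.le (jap_le_of_abs_le one_le_two h) hs
    have h2 : jap ((k : ℝ) - k₁) ^ (-l) ≤ jap ((k : ℝ) - k₁) := by
      conv_rhs => rw [← Real.rpow_one (jap ((k : ℝ) - k₁))]
      exact Real.rpow_le_rpow_of_exponent_le (one_le_jap _) (by linarith)
    have h3 := le_rpow_half_of_sq_le (H₁ k k₁ τ τ₁)
    rw [Real.mul_rpow hC₁.le (by linarith)] at h3
    have h4 : jap (k₁ : ℝ) ^ s * jap (k₁ : ℝ) ^ (-s) = 1 := by
      rw [← Real.rpow_add hk₁, add_neg_cancel, Real.rpow_zero]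
    calc jap (k : ℝ) ^ s * jap (k₁ : ℝ) ^ (-s) * jap ((k : ℝ) - k₁) ^ (-l)
        ≤ 2 ^ s * jap (k₁ : ℝ) ^ s * jap (k₁ : ℝ) ^ (-s) * jap ((k : ℝ) - k₁) := by gcongr
      _ = 2 ^ s * jap ((k : ℝ) - k₁) := by rw [mul_assoc (2 ^ s), h4, mul_one]
      _ ≤ 2 ^ s * (C₁ ^ (1 / 2 : ℝ) * modSum α β ε k k₁ τ τ₁ ^ (1 / 2 : ℝ)) := by gcongr
      _ = 2 ^ s * C₁ ^ (1 / 2 : ℝ) * modSum α β ε k k₁ τ τ₁ ^ (1 / 2 : ℝ) := by ring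
      _ ≤ _ := le_add_of_nonneg_right (by positivity)
  · obtain ⟨c1, c2⟩ := jap_sub_comparable h
    have h1 := rpow_le_two_rpow_mul (a := -l) hd.le hk c1 c2
    have h2 : jap (k₁ : ℝ) ^ (-s) ≤ 1 :=
      Real.rpow_le_one_of_one_le_of_nonpos (one_le_jap _) (by linarith)
    have h3 : jap (k : ℝ) ^ s * jap (k : ℝ) ^ (-l) ≤ jap (k : ℝ) ^ 2 := by
      rw [← Real.rpow_add hk, ← Real.rpow_natCast]
      exact Real.rpow_le_rpow_of_exponent_le (one_le_jap _) (by push_cast; linarith)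
    have h4 := le_rpow_half_of_sq_le (x := jap (k : ℝ) ^ 2)
      ((by ring : (jap (k : ℝ) ^ 2) ^ 2 = jap (k : ℝ) ^ 4).trans_le (H₂ k k₁ τ τ₁ h))
    rw [Real.mul_rpow hC₂.le (by linarith)] at h4
    calc jap (k : ℝ) ^ s * jap (k₁ : ℝ) ^ (-s) * jap ((k : ℝ) - k₁) ^ (-l)
        ≤ jap (k : ℝ) ^ s * 1 * (2 ^ |(-l)| * jap (k : ℝ) ^ (-l)) := by gcongr
      _ = 2 ^ |(-l)| * (jap (k : ℝ) ^ s * jap (k : ℝ) ^ (-l)) := by ring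
      _ ≤ 2 ^ |(-l)| * (C₂ ^ (1 / 2 : ℝ) * modSum α β ε k k₁ τ τ₁ ^ (1 / 2 : ℝ)) := by
          exact mul_le_mul_of_nonneg_left (h3.trans h4) (by positivity)
      _ = 2 ^ |(-l)| * C₂ ^ (1 / 2 : ℝ) * modSum α β ε k k₁ τ τ₁ ^ (1 / 2 : ℝ) := by ring
      _ ≤ _ := le_add_of_nonneg_left (by positivity)

/-- The multiplier of the wave estimate gains half a power of the modulations. -/
lemma exists_wave_multiplier_le {α β ε ρ s l : ℝ} (hα : 0 < α) (hβ : 0 < β) (hε : 0 < ε)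
    (hρ : 0 < ρ) (hs : 0 ≤ s) (hl : l ≤ 2 * s + 1 - ρ) (hsl : -2 + ρ ≤ s - l) :
    ∃ C : ℝ, 0 < C ∧ ∀ (k k₁ : ℤ) (τ τ₁ : ℝ),
      |(k : ℝ) - k₁| ^ ρ * jap ((k : ℝ) - k₁) ^ l * jap (k : ℝ) ^ (-s) * jap (k₁ : ℝ) ^ (-s) ≤
        C * modSum α β ε k k₁ τ τ₁ ^ (1 / 2 : ℝ) := by
  obtain ⟨C₁, hC₁, H₁⟩ := exists_jap_sq_le_modSum hα hβ hε
  obtain ⟨C₂, hC₂, H₂⟩ := exists_jap_pow_four_le_modSum hα hβ hε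
  set C := 6 ^ s * C₁ ^ (1 / 2 : ℝ) + 2 ^ |ρ + l| * C₂ ^ (1 / 2 : ℝ) with hC
  -- by symmetry `|k₁| ≤ |k|`
  have key : ∀ (k k₁ : ℤ) (τ τ₁ : ℝ), |(k₁ : ℝ)| ≤ |(k : ℝ)| →
      |(k : ℝ) - k₁| ^ ρ * jap ((k : ℝ) - k₁) ^ l * jap (k : ℝ) ^ (-s) * jap (k₁ : ℝ) ^ (-s) ≤
        C * modSum α β ε k k₁ τ τ₁ ^ (1 / 2 : ℝ) := by
    intro k k₁ τ τ₁ hkk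
    have hS := one_le_modSum α β ε k k₁ τ τ₁
    have hSp : 0 ≤ modSum α β ε k k₁ τ τ₁ ^ (1 / 2 : ℝ) := by positivity
    have hk := jap_pos (k : ℝ)
    have hk₁ := jap_pos (k₁ : ℝ)
    have hd := jap_pos ((k : ℝ) - k₁)
    have h0 : |(k : ℝ) - k₁| ^ ρ * jap ((k : ℝ) - k₁) ^ l ≤ jap ((k : ℝ) - k₁) ^ (ρ + l) := by
      rw [Real.rpow_add hd]
      gcongr
      exact abs_le_jap _
    rw [hC, add_mul]
    rcases le_total |(k : ℝ)| (2 * |(k₁ : ℝ)|) with h | h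
    · have hneg : ∀ {c X : ℝ}, 0 < c → 0 < X → jap ((k : ℝ) - k₁) ≤ c * X →
          X ^ (-s) ≤ c ^ s * jap ((k : ℝ) - k₁) ^ (-s) := by
        intro c X hc hX hle
        have h1 := Real.rpow_le_rpow_of_nonpos hd hle (show -s ≤ 0 by linarith)
        rw [Real.mul_rpow hc.le hX.le, Real.rpow_neg hc.le] at h1
        calc X ^ (-s) = c ^ s * ((c ^ s)⁻¹ * X ^ (-s)) := by field_simp
          _ ≤ _ := by gcongr
      have h1 := hneg (c := 2) two_pos hk
        (jap_le_of_abs_le one_le_two (by linarith [abs_sub (k : ℝ) k₁]))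
      have h2 := hneg (c := 3) three_pos hk₁
        (jap_le_of_abs_le (by norm_num) (by linarith [abs_sub (k : ℝ) k₁]))
      have h3 := le_rpow_half_of_sq_le (H₁ k k₁ τ τ₁)
      rw [Real.mul_rpow hC₁.le (by linarith)] at h3
      have h4 : jap ((k : ℝ) - k₁) ^ (ρ + l) * jap ((k : ℝ) - k₁) ^ (-s) *
          jap ((k : ℝ) - k₁) ^ (-s) ≤ jap ((k : ℝ) - k₁) := by
        rw [← Real.rpow_add hd, ← Real.rpow_add hd]
        conv_rhs => rw [← Real.rpow_one (jap ((k : ℝ) - k₁))]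
        exact Real.rpow_le_rpow_of_exponent_le (one_le_jap _) (by linarith)
      have h6 : (6 : ℝ) ^ s = 2 ^ s * 3 ^ s := by
        rw [← Real.mul_rpow zero_le_two (by norm_num)]; norm_num
      calc _ ≤ jap ((k : ℝ) - k₁) ^ (ρ + l) * (2 ^ s * jap ((k : ℝ) - k₁) ^ (-s)) *
            (3 ^ s * jap ((k : ℝ) - k₁) ^ (-s)) := by gcongr
        _ = 6 ^ s * (jap ((k : ℝ) - k₁) ^ (ρ + l) * jap ((k : ℝ) - k₁) ^ (-s) *
            jap ((k : ℝ) - k₁) ^ (-s)) := by rw [h6]; ring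
        _ ≤ 6 ^ s * (C₁ ^ (1 / 2 : ℝ) * modSum α β ε k k₁ τ τ₁ ^ (1 / 2 : ℝ)) := by
            exact mul_le_mul_of_nonneg_left (h4.trans h3) (by positivity)
        _ = 6 ^ s * C₁ ^ (1 / 2 : ℝ) * modSum α β ε k k₁ τ τ₁ ^ (1 / 2 : ℝ) := by ring
        _ ≤ _ := le_add_of_nonneg_right (by positivity)
    · obtain ⟨c1, c2⟩ := jap_sub_comparable h
      have h1 := rpow_le_two_rpow_mul (a := ρ + l) hd.le hk c1 c2
      have h2 : jap (k₁ : ℝ) ^ (-s) ≤ 1 :=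
        Real.rpow_le_one_of_one_le_of_nonpos (one_le_jap _) (by linarith)
      have h3 : jap (k : ℝ) ^ (ρ + l) * jap (k : ℝ) ^ (-s) ≤ jap (k : ℝ) ^ 2 := by
        rw [← Real.rpow_add hk, ← Real.rpow_natCast]
        exact Real.rpow_le_rpow_of_exponent_le (one_le_jap _) (by push_cast; linarith)
      have h4 := le_rpow_half_of_sq_le (x := jap (k : ℝ) ^ 2)
        ((by ring : (jap (k : ℝ) ^ 2) ^ 2 = jap (k : ℝ) ^ 4).trans_le (H₂ k k₁ τ τ₁ h))
      rw [Real.mul_rpow hC₂.le (by linarith)] at h4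
      calc _ ≤ 2 ^ |ρ + l| * jap (k : ℝ) ^ (ρ + l) * jap (k : ℝ) ^ (-s) * 1 := by
            refine mul_le_mul (mul_le_mul_of_nonneg_right (h0.trans h1) ?_) h2 ?_ ?_ <;>
              positivity
        _ = 2 ^ |ρ + l| * (jap (k : ℝ) ^ (ρ + l) * jap (k : ℝ) ^ (-s)) := by ring
        _ ≤ 2 ^ |ρ + l| * (C₂ ^ (1 / 2 : ℝ) * modSum α β ε k k₁ τ τ₁ ^ (1 / 2 : ℝ)) := by
            exact mul_le_mul_of_nonneg_left (h3.trans h4) (by positivity)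
        _ = 2 ^ |ρ + l| * C₂ ^ (1 / 2 : ℝ) * modSum α β ε k k₁ τ τ₁ ^ (1 / 2 : ℝ) := by ring
        _ ≤ _ := le_add_of_nonneg_left (by positivity)
  refine ⟨C, by positivity, fun k k₁ τ τ₁ => ?_⟩
  rcases le_total |(k₁ : ℝ)| |(k : ℝ)| with h | h
  · exact key k k₁ τ τ₁ h
  · have := key k₁ k τ₁ τ h
    rw [modSum_swap, abs_sub_comm, ← neg_sub (k : ℝ), jap_neg] at this
    linarith

/-! ### The frequency group and kernel bounds -/

/-- The invariant measure of the frequency group `ℤ × ℝ`: counting measure times Lebesgue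
measure. -/
noncomputable abbrev freqMeasure : Measure (ℤ × ℝ) := Measure.count.prod volume

lemma lintegral_freqMeasure {f : ℤ × ℝ → ℝ≥0∞} (hf : Measurable f) :
    ∫⁻ x, f x ∂freqMeasure = ∑' k : ℤ, ∫⁻ τ : ℝ, f (k, τ) := by
  rw [lintegral_prod _ hf.aemeasurable, lintegral_count]

lemma measurable_of_forall_section {β : Type*} [MeasurableSpace β] {f : ℤ × ℝ → β}
    (h : ∀ k, Measurable fun τ => f (k, τ)) : Measurable f :=
  measurable_from_prod_countable_right h

@[fun_prop]
lemma measurable_phaseS (α ε : ℝ) : Measurable fun x : ℤ × ℝ => phaseS α ε x.1 x.2 := by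
  unfold phaseS; fun_prop

@[fun_prop]
lemma measurable_phaseW (β ε : ℝ) : Measurable fun x : ℤ × ℝ => phaseW β ε x.1 x.2 := by
  unfold phaseW; fun_prop

instance : freqMeasure.IsNegInvariant where
  neg_eq_self := ((Measure.measurePreserving_neg (Measure.count : Measure ℤ)).prod
    (Measure.measurePreserving_neg (volume : Measure ℝ))).map_eq

/-- The Schrödinger modulation `⟨τ + α k² + ε² k⁴⟩`. -/
noncomputable def modS (α ε : ℝ) (x : ℤ × ℝ) : ℝ := jap (phaseS α ε x.1 x.2)

/-- The wave modulation `⟨|τ| - β |k| ⟨ε k⟩⟩`. -/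
noncomputable def modW (β ε : ℝ) (x : ℤ × ℝ) : ℝ := jap (phaseW β ε x.1 x.2)

lemma one_le_modS (α ε : ℝ) (x : ℤ × ℝ) : 1 ≤ modS α ε x := one_le_jap _

lemma modS_pos (α ε : ℝ) (x : ℤ × ℝ) : 0 < modS α ε x := jap_pos _

lemma modW_pos (β ε : ℝ) (x : ℤ × ℝ) : 0 < modW β ε x := jap_pos _

@[simp] lemma modW_neg (β ε : ℝ) (x : ℤ × ℝ) : modW β ε (-x) = modW β ε x := by
  simp [modW]

@[fun_prop]
lemma measurable_modS (α ε : ℝ) : Measurable (modS α ε) :=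
  measurable_jap.comp (measurable_phaseS α ε)

@[fun_prop]
lemma measurable_modW (β ε : ℝ) : Measurable (modW β ε) :=
  measurable_jap.comp (measurable_phaseW β ε)

/-- The `τ`-integral of a product of two modulations decays in the sum of the two phases. -/
lemma lintegral_jap_mul_le {p q γ : ℝ} (hγ : 0 ≤ γ) (hp : γ ≤ p) (hq : γ ≤ q)
    (hr : 1 < p + q - γ) : ∃ C : ℝ, 0 < C ∧ ∀ A B : ℝ,
      ∫⁻ τ : ℝ, ENNReal.ofReal (jap (τ + A) ^ (-p) * jap (B - τ) ^ (-q)) ≤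
        ENNReal.ofReal (C * jap (A + B) ^ (-γ)) := by
  have hint := integrable_jap_rpow hr
  set I := ∫ x : ℝ, jap x ^ (-(p + q - γ)) with hI
  have hI0 : 0 ≤ I := integral_nonneg fun x => Real.rpow_nonneg (jap_pos x).le _
  refine ⟨2 ^ γ * (I + I) + 1, by positivity, fun A B => ?_⟩
  have hi1 : Integrable fun τ : ℝ => jap (τ + A) ^ (-(p + q - γ)) := hint.comp_add_right A
  have hi2 : Integrable fun τ : ℝ => jap (B - τ) ^ (-(p + q - γ)) := hint.comp_sub_left B
  have hZ : 0 ≤ jap (A + B) ^ (-γ) := Real.rpow_nonneg (jap_pos _).le _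
  calc _ ≤ ∫⁻ τ : ℝ, ENNReal.ofReal (2 ^ γ * jap (A + B) ^ (-γ) *
          (jap (τ + A) ^ (-(p + q - γ)) + jap (B - τ) ^ (-(p + q - γ)))) := by
        refine lintegral_mono fun τ => ENNReal.ofReal_le_ofReal ?_
        have h := jap_rpow_mul_le hγ hp hq (τ + A) (B - τ)
        rwa [show τ + A + (B - τ) = A + B by ring] at h
    _ = ENNReal.ofReal (2 ^ γ * jap (A + B) ^ (-γ) * (I + I)) := by
        rw [← ofReal_integral_eq_lintegral_ofReal (by exact (hi1.add hi2).const_mul _)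
          (.of_forall fun τ => mul_nonneg (by positivity) (add_nonneg
            (Real.rpow_nonneg (jap_pos _).le _) (Real.rpow_nonneg (jap_pos _).le _))),
          integral_const_mul, integral_add hi1 hi2,
          integral_add_right_eq_self (fun t => jap t ^ (-(p + q - γ))) A,
          integral_sub_left_eq_self (fun t => jap t ^ (-(p + q - γ))) volume B]
    _ ≤ _ := by
        refine ENNReal.ofReal_le_ofReal ?_
        nlinarith

lemma tsum_ofReal_le_of_sum_le {f : ℤ → ℝ} {C : ℝ} (hf : ∀ k, 0 ≤ f k)
    (h : ∀ F : Finset ℤ, ∑ k ∈ F, f k ≤ C) :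
    ∑' k, ENNReal.ofReal (f k) ≤ ENNReal.ofReal C := by
  rw [ENNReal.tsum_eq_iSup_sum]
  refine iSup_le fun F => ?_
  rw [← ENNReal.ofReal_sum_of_nonneg fun k _ => hf k]
  exact ENNReal.ofReal_le_ofReal (h F)

/-- A bounded perturbation of the phase costs only a constant. -/
lemma jap_add_rpow_le {γ D : ℝ} (hγ : 0 ≤ γ) (x θ : ℝ) (hθ : |θ| ≤ D) :
    jap x ^ (-γ) ≤ (2 + D) ^ γ * jap (x + θ) ^ (-γ) := by
  have hD : 0 ≤ D := (abs_nonneg _).trans hθ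
  have h1 : jap (x + θ) ≤ (2 + D) * jap x := by
    have := jap_add_le x θ
    nlinarith [jap_le_one_add_abs θ, one_le_jap x]
  have h2 := Real.rpow_le_rpow_of_nonpos (z := -γ) (jap_pos _) h1 (by linarith)
  rw [Real.mul_rpow (by positivity) (jap_pos _).le, Real.rpow_neg (by positivity : 0 ≤ 2 + D)] at h2
  have : 0 < (2 + D) ^ γ := by positivity
  calc jap x ^ (-γ) = (2 + D) ^ γ * (((2 + D) ^ γ)⁻¹ * jap x ^ (-γ)) := by field_simp
    _ ≤ _ := by gcongr

/-- The wave frequency is `β ε y²` up to a bounded error, so the phase of a Schrödinger and a wave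
interaction is a quartic whose quadratic coefficient is fixed. The sign `δ = ±1` is that of the
wave. -/
lemma exists_sum_schrodinger_wave_le {α β ε γ δ : ℝ} (hβ : 0 < β) (hε : 0 < ε)
    (hγ : 1 / 3 < γ) (hδ : |δ| ≤ 1) :
    ∃ C : ℝ, 0 < C ∧ ∀ (m : ℤ) (t : ℝ) (F : Finset ℤ),
      ∑ k ∈ F, jap ((α * (k : ℝ) ^ 2 + ε ^ 2 * (k : ℝ) ^ 4) +
        (t + δ * (β * |(m : ℝ) - k| * jap (ε * ((m : ℝ) - k))))) ^ (-γ) ≤ C := by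
  obtain ⟨C, hC, H⟩ := exists_sum_jap_rpow_le_of_quartic (A := α + δ * β * ε) hγ
    (show 0 < ε ^ 2 by positivity)
  refine ⟨(2 + β / (2 * ε)) ^ γ * C, by positivity, fun m t F => ?_⟩
  calc _ ≤ ∑ k ∈ F, (2 + β / (2 * ε)) ^ γ * jap (ε ^ 2 * (k : ℝ) ^ 4 +
        (α + δ * β * ε) * (k : ℝ) ^ 2 + (-2 * δ * β * ε * m) * k +
          (t + δ * β * ε * m ^ 2)) ^ (-γ) := by
        refine Finset.sum_le_sum fun k _ => ?_
        have h1 := mul_sq_le_waveFreq hβ hε ((m : ℝ) - k)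
        have h2 := waveFreq_le hβ hε ((m : ℝ) - k)
        set ω := β * |(m : ℝ) - k| * jap (ε * ((m : ℝ) - k))
        refine (jap_add_rpow_le (D := β / (2 * ε)) (by linarith) _
          (δ * (β * ε * ((m : ℝ) - k) ^ 2 - ω)) ?_).trans_eq ?_
        · rw [abs_mul, abs_of_nonpos (show β * ε * ((m : ℝ) - k) ^ 2 - ω ≤ 0 by linarith)]
          exact (mul_le_of_le_one_left (by linarith) hδ).trans (by linarith)
        · congr 3; ring
    _ ≤ _ := by
        rw [← Finset.mul_sum]
        gcongr
        exact H _ _ F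

/-- Interactions of a Schrödinger and a wave modulation: the phase is quartic in the Schrödinger
frequency. -/
lemma exists_lintegral_modS_modW_le {α β ε p q γ : ℝ} (hβ : 0 < β) (hε : 0 < ε)
    (hγ : 1 / 3 < γ) (hp : γ ≤ p) (hq : γ ≤ q) (hr : 1 < p + q - γ) :
    ∃ C : ℝ, 0 < C ∧ ∀ y : ℤ × ℝ,
      ∫⁻ x, ENNReal.ofReal (modS α ε x ^ (-p) * modW β ε (y - x) ^ (-q)) ∂freqMeasure ≤
        ENNReal.ofReal C := by
  obtain ⟨C₀, hC₀, H₀⟩ := lintegral_jap_mul_le (by linarith) hp hq hr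
  obtain ⟨C₁, hC₁, H₁⟩ := exists_sum_schrodinger_wave_le (α := α) (δ := 1) hβ hε hγ (by simp)
  obtain ⟨C₂, hC₂, H₂⟩ := exists_sum_schrodinger_wave_le (α := α) (δ := -1) hβ hε hγ (by simp)
  refine ⟨C₀ * (C₂ + C₁), by positivity, fun y => ?_⟩
  rw [lintegral_freqMeasure (by fun_prop)]
  have hnn : ∀ t : ℝ, 0 ≤ jap t ^ (-γ) := fun t => Real.rpow_nonneg (jap_pos t).le _
  set P : ℤ → ℝ := fun k => α * (k : ℝ) ^ 2 + ε ^ 2 * (k : ℝ) ^ 4 with hP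
  set ω : ℤ → ℝ := fun k => β * |(y.1 : ℝ) - k| * jap (ε * ((y.1 : ℝ) - k)) with hω
  have hsec : ∀ k : ℤ,
      ∫⁻ τ : ℝ, ENNReal.ofReal (modS α ε (k, τ) ^ (-p) * modW β ε (y - (k, τ)) ^ (-q)) ≤
        ENNReal.ofReal (C₀ * (jap (P k + (y.2 + -1 * ω k)) ^ (-γ) +
          jap (P k + (y.2 + 1 * ω k)) ^ (-γ))) := by
    intro k
    calc _ ≤ ∫⁻ τ : ℝ, (ENNReal.ofReal (jap (τ + P k) ^ (-p) *
            jap ((y.2 + -1 * ω k) - τ) ^ (-q)) + ENNReal.ofReal (jap (τ + P k) ^ (-p) *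
            jap ((y.2 + 1 * ω k) - τ) ^ (-q))) := by
          refine lintegral_mono fun τ => ?_
          have hn1 : ∀ t r : ℝ, 0 ≤ jap t ^ r := fun t r => Real.rpow_nonneg (jap_pos t).le _
          rw [← ENNReal.ofReal_add (mul_nonneg (hn1 _ _) (hn1 _ _))
            (mul_nonneg (hn1 _ _) (hn1 _ _)), ← mul_add]
          have e1 : modS α ε (k, τ) = jap (τ + P k) := by
            simp only [modS, phaseS, hP, add_assoc]
          have e2 : modW β ε (y - (k, τ)) = jap (|y.2 - τ| - ω k) := by
            simp [modW, phaseW, hω]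
          rw [e1, e2]
          refine ENNReal.ofReal_le_ofReal (mul_le_mul_of_nonneg_left ?_ (hn1 _ _))
          rcases abs_cases (y.2 - τ) with ⟨h, -⟩ | ⟨h, -⟩
          · rw [h, show y.2 + -1 * ω k - τ = y.2 - τ - ω k by ring]
            exact le_add_of_nonneg_right (hn1 _ _)
          · rw [h, ← jap_neg, show -(-(y.2 - τ) - ω k) = y.2 + 1 * ω k - τ by ring]
            exact le_add_of_nonneg_left (hn1 _ _)
      _ ≤ _ := by
          rw [lintegral_add_left (by fun_prop), mul_add, ENNReal.ofReal_add
            (mul_nonneg hC₀.le (hnn _)) (mul_nonneg hC₀.le (hnn _))]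
          exact add_le_add (H₀ _ _) (H₀ _ _)
  refine (ENNReal.tsum_le_tsum hsec).trans (tsum_ofReal_le_of_sum_le
    (fun k => mul_nonneg hC₀.le (add_nonneg (hnn _) (hnn _))) fun F => ?_)
  rw [← Finset.mul_sum, Finset.sum_add_distrib]
  exact mul_le_mul_of_nonneg_left (add_le_add (H₂ y.1 y.2 F) (H₁ y.1 y.2 F)) hC₀.le

/-- Interactions of two Schrödinger modulations at distinct spatial frequencies: the phase is a
cubic polynomial, increasing or decreasing at a cubic rate. -/
lemma exists_lintegral_modS_modS_le {α ε p q γ : ℝ} (hα : 0 < α) (hε : 0 < ε)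
    (hγ : 1 / 3 < γ) (hp : γ ≤ p) (hq : γ ≤ q) (hr : 1 < p + q - γ) :
    ∃ C : ℝ, 0 < C ∧ ∀ z : ℤ × ℝ, z.1 ≠ 0 →
      ∫⁻ y, ENNReal.ofReal (modS α ε y ^ (-p) * modS α ε (y + z) ^ (-q)) ∂freqMeasure ≤
        ENNReal.ofReal C := by
  obtain ⟨C₀, hC₀, H₀⟩ := lintegral_jap_mul_le (by linarith) hp hq hr
  obtain ⟨C₁, hC₁, H₁⟩ := exists_sum_jap_rpow_le_of_separated hγ (show 0 < ε ^ 2 by positivity)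
  refine ⟨C₀ * C₁, by positivity, fun z hz => ?_⟩
  rw [lintegral_freqMeasure (by fun_prop)]
  have hnn : ∀ t : ℝ, 0 ≤ jap t ^ (-γ) := fun t => Real.rpow_nonneg (jap_pos t).le _
  set P : ℝ → ℝ := fun k => α * k ^ 2 + ε ^ 2 * k ^ 4 with hP
  have hsec : ∀ k : ℤ,
      ∫⁻ τ : ℝ, ENNReal.ofReal (modS α ε (k, τ) ^ (-p) * modS α ε ((k, τ) + z) ^ (-q)) ≤
        ENNReal.ofReal (C₀ * jap (P k + (-z.2 - P (k + z.1))) ^ (-γ)) := by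
    intro k
    refine le_trans (le_of_eq (lintegral_congr fun τ => ?_)) (H₀ (P k) (-z.2 - P (k + z.1)))
    have e1 : modS α ε (k, τ) = jap (τ + P k) := by
      simp only [modS, phaseS, hP, add_assoc]
    have e2 : modS α ε ((k, τ) + z) = jap (-z.2 - P (k + z.1) - τ) := by
      rw [← jap_neg]
      simp only [modS, phaseS, hP, Prod.fst_add, Prod.snd_add, Int.cast_add]
      congr 1; ring
    rw [e1, e2]
  refine (ENNReal.tsum_le_tsum hsec).trans (tsum_ofReal_le_of_sum_le
    (fun k => mul_nonneg hC₀.le (hnn _)) fun F => ?_)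
  rw [← Finset.mul_sum]
  refine mul_le_mul_of_nonneg_left
    (H₁ (fun k => P k + (-z.2 - P (k + z.1))) F fun x y => ?_) hC₀.le
  have hm : 1 ≤ |(z.1 : ℝ)| := by exact_mod_cast Int.one_le_abs hz
  -- centering the cubic at `-z.1 / 2` removes its even terms
  have hid : (P x + (-z.2 - P (x + z.1))) - (P y + (-z.2 - P (y + z.1))) =
      -(z.1 * ((x : ℝ) - y) * (2 * α + ε ^ 2 * (4 * ((x + z.1 / 2 : ℝ) ^ 2 +
        (x + z.1 / 2) * (y + z.1 / 2) + (y + z.1 / 2) ^ 2) + z.1 ^ 2))) := by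
    simp only [hP]; ring
  have hq : ((x : ℝ) - y) ^ 2 ≤ 4 * ((x + z.1 / 2 : ℝ) ^ 2 +
        (x + z.1 / 2) * (y + z.1 / 2) + (y + z.1 / 2) ^ 2) + (z.1 : ℝ) ^ 2 := by
    nlinarith [sq_nonneg ((x : ℝ) + y + z.1), sq_nonneg (z.1 : ℝ)]
  rw [hid, abs_neg, abs_mul, abs_mul]
  calc ε ^ 2 * |(x : ℝ) - y| ^ 3 = 1 * |(x : ℝ) - y| * (ε ^ 2 * ((x : ℝ) - y) ^ 2) := by
        rw [← sq_abs ((x : ℝ) - y)]; ring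
    _ ≤ _ := by
        refine mul_le_mul (mul_le_mul_of_nonneg_right hm (abs_nonneg _))
          (le_trans ?_ (le_abs_self _))
          (by positivity) (by positivity)
        have := mul_le_mul_of_nonneg_left hq (sq_nonneg ε)
        linarith

/-! ### Bilinear estimates by Cauchy–Schwarz -/

section CauchySchwarz

variable {G : Type*} [MeasurableSpace G] {μ : Measure G}

lemma sq_lintegral_mul_le {f g : G → ℝ≥0∞} (hf : Measurable f) (hg : Measurable g) :
    (∫⁻ y, f y * g y ∂μ) ^ 2 ≤ (∫⁻ y, f y ^ 2 ∂μ) * ∫⁻ y, g y ^ 2 ∂μ := by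
  have h := ENNReal.lintegral_mul_le_Lp_mul_Lq μ Real.HolderConjugate.two_two
    hf.aemeasurable hg.aemeasurable
  simp only [Pi.mul_apply, ENNReal.rpow_two] at h
  calc _ ≤ ((∫⁻ y, f y ^ 2 ∂μ) ^ (1 / 2 : ℝ) * (∫⁻ y, g y ^ 2 ∂μ) ^ (1 / 2 : ℝ)) ^ 2 := by gcongr
    _ = _ := by
      rw [mul_pow, ← ENNReal.rpow_two, ← ENNReal.rpow_two, ← ENNReal.rpow_mul, ← ENNReal.rpow_mul]
      norm_num

variable [AddCommGroup G] [MeasurableAdd₂ G] [MeasurableNeg G] [SFinite μ]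
  [μ.IsAddLeftInvariant] {f g : G → ℝ≥0∞} {K : G → G → ℝ≥0∞} {B : ℝ≥0∞}

/-- Kernel bounded in `L²` of the integration variable, uniformly in the output variable. -/
lemma lintegral_sq_conv_le_of_output (hf : Measurable f) (hg : Measurable g)
    (hK : Measurable (Function.uncurry K)) (hB : ∀ x, ∫⁻ y, K x y ^ 2 ∂μ ≤ B) :
    ∫⁻ x, (∫⁻ y, K x y * (f y * g (x - y)) ∂μ) ^ 2 ∂μ ≤
      B * ((∫⁻ y, f y ^ 2 ∂μ) * ∫⁻ z, g z ^ 2 ∂μ) := by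
  have : MeasurableSub₂ G := ⟨by simp_rw [sub_eq_add_neg]; fun_prop⟩
  calc _ ≤ ∫⁻ x, B * ∫⁻ y, (f y * g (x - y)) ^ 2 ∂μ ∂μ := by
        refine lintegral_mono fun x => ?_
        refine (sq_lintegral_mul_le (hK.comp (by fun_prop : Measurable fun y => (x, y)))
          (by fun_prop)).trans ?_
        gcongr
        exact hB x
    _ = B * ∫⁻ y, ∫⁻ x, (f y * g (x - y)) ^ 2 ∂μ ∂μ := by
        rw [lintegral_const_mul, lintegral_lintegral_swap]
        · exact Measurable.aemeasurable (by fun_prop)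
        · exact Measurable.lintegral_prod_right' (f := fun p : G × G => (f p.2 * g (p.1 - p.2)) ^ 2)
            (by fun_prop)
    _ = _ := by
        congr 1
        simp_rw [mul_pow]
        rw [← lintegral_mul_const _ (by fun_prop)]
        refine lintegral_congr fun y => ?_
        rw [lintegral_const_mul _ (by fun_prop),
          lintegral_sub_right_eq_self (fun z => g z ^ 2) y]

/-- Kernel bounded in `L²` of the output variable, uniformly in the variable of the first factor. -/
lemma lintegral_sq_conv_le_of_left [μ.IsNegInvariant] (hf : Measurable f) (hg : Measurable g)
    (hK : Measurable (Function.uncurry K)) (hB : ∀ y, ∫⁻ x, K x y ^ 2 ∂μ ≤ B) :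
    ∫⁻ x, (∫⁻ y, K x y * (f y * g (x - y)) ∂μ) ^ 2 ∂μ ≤
      B * ((∫⁻ y, f y ^ 2 ∂μ) * ∫⁻ z, g z ^ 2 ∂μ) := by
  have : MeasurableSub₂ G := ⟨by simp_rw [sub_eq_add_neg]; fun_prop⟩
  have hK1 : ∀ x, Measurable fun y => K x y := fun x =>
    hK.comp (by fun_prop : Measurable fun y => (x, y))
  have hK2 : ∀ y, Measurable fun x => K x y := fun y =>
    hK.comp (by fun_prop : Measurable fun x => (x, y))
  calc _ ≤ ∫⁻ x, (∫⁻ y, (K x y * f y) ^ 2 ∂μ) * ∫⁻ z, g z ^ 2 ∂μ ∂μ := by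
        refine lintegral_mono fun x => ?_
        simp_rw [← mul_assoc]
        refine (sq_lintegral_mul_le ((hK1 x).mul hf) (by fun_prop)).trans_eq ?_
        rw [lintegral_sub_left_eq_self (fun z => g z ^ 2) x]
        rfl
    _ = (∫⁻ y, ∫⁻ x, (K x y * f y) ^ 2 ∂μ ∂μ) * ∫⁻ z, g z ^ 2 ∂μ := by
        rw [lintegral_mul_const, lintegral_lintegral_swap]
        · exact ((hK.mul (hf.comp measurable_snd)).pow_const 2).aemeasurable
        · exact Measurable.lintegral_prod_right' (f := fun p : G × G => (K p.1 p.2 * f p.2) ^ 2)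
            ((hK.mul (hf.comp measurable_snd)).pow_const 2)
    _ ≤ (∫⁻ y, B * f y ^ 2 ∂μ) * ∫⁻ z, g z ^ 2 ∂μ := by
        gcongr with y
        simp_rw [mul_pow]
        rw [lintegral_mul_const _ ((hK2 y).pow_const 2)]
        gcongr
        exact hB y
    _ = _ := by rw [lintegral_const_mul _ (by fun_prop), mul_assoc]

/-- Kernel bounded in `L²` along the lines where the variable of the second factor is constant. -/
lemma lintegral_sq_conv_le_of_right (hf : Measurable f) (hg : Measurable g)
    (hK : Measurable (Function.uncurry K)) (hB : ∀ z, ∫⁻ y, K (y + z) y ^ 2 ∂μ ≤ B) :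
    ∫⁻ x, (∫⁻ y, K x y * (f y * g (x - y)) ∂μ) ^ 2 ∂μ ≤
      B * ((∫⁻ y, f y ^ 2 ∂μ) * ∫⁻ z, g z ^ 2 ∂μ) := by
  have : MeasurableSub₂ G := ⟨by simp_rw [sub_eq_add_neg]; fun_prop⟩
  have hK1 : ∀ x, Measurable fun y => K x y := fun x =>
    hK.comp (by fun_prop : Measurable fun y => (x, y))
  have hK3 : ∀ z, Measurable fun y => K (y + z) y := fun z =>
    hK.comp (by fun_prop : Measurable fun y => (y + z, y))
  have hm : Measurable fun p : G × G => (K p.1 p.2 * g (p.1 - p.2)) ^ 2 :=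
    (hK.mul (by fun_prop)).pow_const 2
  calc _ ≤ ∫⁻ x, (∫⁻ y, f y ^ 2 ∂μ) * ∫⁻ y, (K x y * g (x - y)) ^ 2 ∂μ ∂μ := by
        refine lintegral_mono fun x => ?_
        simp_rw [mul_left_comm (K x _)]
        exact sq_lintegral_mul_le hf ((hK1 x).mul (by fun_prop))
    _ = (∫⁻ y, f y ^ 2 ∂μ) * ∫⁻ y, ∫⁻ x, (K x y * g (x - y)) ^ 2 ∂μ ∂μ := by
        rw [lintegral_const_mul, lintegral_lintegral_swap]
        · exact hm.aemeasurable
        · exact hm.lintegral_prod_right'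
    _ = (∫⁻ y, f y ^ 2 ∂μ) * ∫⁻ y, ∫⁻ z, (K (y + z) y * g z) ^ 2 ∂μ ∂μ := by
        congr 1
        refine lintegral_congr fun y => ?_
        rw [← lintegral_add_left_eq_self _ y]
        simp only [add_sub_cancel_left]
    _ = (∫⁻ y, f y ^ 2 ∂μ) * ∫⁻ z, ∫⁻ y, (K (y + z) y * g z) ^ 2 ∂μ ∂μ := by
        rw [lintegral_lintegral_swap]
        refine Measurable.aemeasurable (Measurable.pow_const (Measurable.mul ?_ (by fun_prop)) 2)
        exact hK.comp (by fun_prop : Measurable fun p : G × G => (p.1 + p.2, p.1))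
    _ ≤ (∫⁻ y, f y ^ 2 ∂μ) * ∫⁻ z, B * g z ^ 2 ∂μ := by
        gcongr with z
        simp_rw [mul_pow]
        rw [lintegral_mul_const _ ((hK3 z).pow_const 2)]
        gcongr
        exact hB z
    _ = _ := by rw [lintegral_const_mul _ (by fun_prop), mul_left_comm]

lemma ennreal_add_sq_le (a b : ℝ≥0∞) : (a + b) ^ 2 ≤ 4 * (a ^ 2 + b ^ 2) := by
  have key : ∀ a b : ℝ≥0∞, a ≤ b → (a + b) ^ 2 ≤ 4 * (a ^ 2 + b ^ 2) := fun a b h =>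
    calc (a + b) ^ 2 ≤ (2 * b) ^ 2 := by gcongr; rw [two_mul]; gcongr
      _ = 4 * b ^ 2 := by rw [mul_pow]; norm_num
      _ ≤ _ := by gcongr; exact le_add_self
  rcases le_total a b with h | h
  · exact key a b h
  · rw [add_comm a, add_comm (a ^ 2)]; exact key b a h

/-- Three kernels, one for each of the three modulations that can be the largest one. -/
lemma lintegral_sq_le_of_three_kernels [μ.IsNegInvariant] {Φ K₁ K₂ K₃ : G → G → ℝ≥0∞}
    {f f' g g' : G → ℝ≥0∞} {C B₁ B₂ B₃ : ℝ≥0∞}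
    (hf : Measurable f) (hf' : Measurable f') (hg : Measurable g) (hg' : Measurable g')
    (hK₁ : Measurable (Function.uncurry K₁)) (hK₂ : Measurable (Function.uncurry K₂))
    (hK₃ : Measurable (Function.uncurry K₃))
    (hB₁ : ∀ x, ∫⁻ y, K₁ x y ^ 2 ∂μ ≤ B₁) (hB₂ : ∀ y, ∫⁻ x, K₂ x y ^ 2 ∂μ ≤ B₂)
    (hB₃ : ∀ z, ∫⁻ y, K₃ (y + z) y ^ 2 ∂μ ≤ B₃)
    (hΦ : ∀ x y, Φ x y ≤ C * (K₁ x y * (f y * g' (x - y)) + K₂ x y * (f' y * g (x - y)) +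
      K₃ x y * (f y * g' (x - y)))) :
    ∫⁻ x, (∫⁻ y, Φ x y ∂μ) ^ 2 ∂μ ≤ C ^ 2 * (16 * (B₁ + B₂ + B₃)) *
      ((∫⁻ y, f y ^ 2 ∂μ) * (∫⁻ y, g' y ^ 2 ∂μ) + (∫⁻ y, f' y ^ 2 ∂μ) * ∫⁻ y, g y ^ 2 ∂μ) := by
  have : MeasurableSub₂ G := ⟨by simp_rw [sub_eq_add_neg]; fun_prop⟩
  have hm : ∀ {K : G → G → ℝ≥0∞} {f g : G → ℝ≥0∞}, Measurable (Function.uncurry K) →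
      Measurable f → Measurable g →
      Measurable fun p : G × G => K p.1 p.2 * (f p.2 * g (p.1 - p.2)) :=
    fun hK hf hg => hK.mul (by fun_prop)
  have hs : ∀ {K : G → G → ℝ≥0∞} {f g : G → ℝ≥0∞}, Measurable (Function.uncurry K) →
      Measurable f → Measurable g → ∀ x, Measurable fun y => K x y * (f y * g (x - y)) :=
    fun hK hf hg x => (hm hK hf hg).comp (by fun_prop : Measurable fun y => (x, y))
  set I₁ : G → ℝ≥0∞ := fun x => ∫⁻ y, K₁ x y * (f y * g' (x - y)) ∂μ with hI₁
  set I₂ : G → ℝ≥0∞ := fun x => ∫⁻ y, K₂ x y * (f' y * g (x - y)) ∂μ with hI₂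
  set I₃ : G → ℝ≥0∞ := fun x => ∫⁻ y, K₃ x y * (f y * g' (x - y)) ∂μ with hI₃
  have hmI₁ : Measurable I₁ := (hm hK₁ hf hg').lintegral_prod_right'
  have hmI₂ : Measurable I₂ := (hm hK₂ hf' hg).lintegral_prod_right'
  have hmI₃ : Measurable I₃ := (hm hK₃ hf hg').lintegral_prod_right'
  calc ∫⁻ x, (∫⁻ y, Φ x y ∂μ) ^ 2 ∂μ
      ≤ ∫⁻ x, C ^ 2 * (16 * (I₁ x ^ 2 + I₂ x ^ 2 + I₃ x ^ 2)) ∂μ := by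
        refine lintegral_mono fun x => ?_
        have h1 : ∫⁻ y, Φ x y ∂μ ≤ C * (I₁ x + I₂ x + I₃ x) := by
          refine (lintegral_mono (hΦ x)).trans_eq ?_
          have hsum : Measurable fun y => K₁ x y * (f y * g' (x - y)) +
              K₂ x y * (f' y * g (x - y)) + K₃ x y * (f y * g' (x - y)) :=
            ((hs hK₁ hf hg' x).add (hs hK₂ hf' hg x)).add (hs hK₃ hf hg' x)
          rw [lintegral_const_mul _ hsum, lintegral_add_right _ (hs hK₃ hf hg' x),
            lintegral_add_right _ (hs hK₂ hf' hg x)]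
        calc _ ≤ (C * (I₁ x + I₂ x + I₃ x)) ^ 2 := by gcongr
          _ = C ^ 2 * (I₁ x + I₂ x + I₃ x) ^ 2 := mul_pow _ _ _
          _ ≤ C ^ 2 * (4 * (4 * (I₁ x ^ 2 + I₂ x ^ 2) + 4 * I₃ x ^ 2)) := by
              gcongr
              refine (ennreal_add_sq_le _ _).trans ?_
              gcongr
              · exact ennreal_add_sq_le _ _
              · exact le_mul_of_one_le_left zero_le (by norm_num)
          _ = _ := by rw [← mul_add, ← mul_assoc 4 4]; norm_num
    _ = C ^ 2 * (16 * (∫⁻ x, I₁ x ^ 2 ∂μ + ∫⁻ x, I₂ x ^ 2 ∂μ + ∫⁻ x, I₃ x ^ 2 ∂μ)) := by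
        rw [lintegral_const_mul _ (by fun_prop), lintegral_const_mul _ (by fun_prop),
          lintegral_add_right _ (by fun_prop), lintegral_add_right _ (by fun_prop)]
    _ ≤ C ^ 2 * (16 * (B₁ * ((∫⁻ y, f y ^ 2 ∂μ) * ∫⁻ y, g' y ^ 2 ∂μ) +
          B₂ * ((∫⁻ y, f' y ^ 2 ∂μ) * ∫⁻ y, g y ^ 2 ∂μ) +
          B₃ * ((∫⁻ y, f y ^ 2 ∂μ) * ∫⁻ y, g' y ^ 2 ∂μ))) := by
        gcongr
        · exact lintegral_sq_conv_le_of_output hf hg' hK₁ hB₁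
        · exact lintegral_sq_conv_le_of_left hf' hg hK₂ hB₂
        · exact lintegral_sq_conv_le_of_right hf hg' hK₃ hB₃
    _ ≤ _ := by
        rw [mul_assoc, mul_assoc]
        gcongr C ^ 2 * (16 * ?_)
        set X := (∫⁻ y, f y ^ 2 ∂μ) * ∫⁻ y, g' y ^ 2 ∂μ
        set Y := (∫⁻ y, f' y ^ 2 ∂μ) * ∫⁻ y, g y ^ 2 ∂μ
        calc B₁ * X + B₂ * Y + B₃ * X ≤ B₁ * (X + Y) + B₂ * (X + Y) + B₃ * (X + Y) := by
              gcongr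
              · exact le_self_add
              · exact le_add_self
              · exact le_self_add
          _ = _ := by ring

end CauchySchwarz

/-! ### The two bilinear estimates for measurable functions -/

/-- The integrand of `weightedNorm`, as a function on `ℤ × ℝ`. -/
noncomputable def weighted (φ : ℤ → ℝ → ℝ) (s b : ℝ) (F : ℤ × ℝ → ℂ) (x : ℤ × ℝ) : ℝ≥0∞ :=
  ENNReal.ofReal (jap (x.1 : ℝ) ^ s * jap (φ x.1 x.2) ^ b * ‖F x‖)

lemma measurable_weighted {φ : ℤ → ℝ → ℝ} (hφ : Measurable fun x : ℤ × ℝ => φ x.1 x.2) (s b : ℝ)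
    {F : ℤ × ℝ → ℂ} (hF : Measurable F) : Measurable (weighted φ s b F) := by
  unfold weighted; fun_prop

lemma add_rpow_half_le {a b : ℝ} (ha : 0 ≤ a) (hb : 0 ≤ b) :
    (a + b) ^ (1 / 2 : ℝ) ≤ a ^ (1 / 2 : ℝ) + b ^ (1 / 2 : ℝ) := by
  simp_rw [← Real.sqrt_eq_rpow]
  refine Real.sqrt_le_iff.2 ⟨by positivity, ?_⟩
  nlinarith [Real.sq_sqrt ha, Real.sq_sqrt hb, Real.sqrt_nonneg a, Real.sqrt_nonneg b,
    mul_nonneg (Real.sqrt_nonneg a) (Real.sqrt_nonneg b)]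

lemma ofReal_kernel_sq_le {h x y : ℝ} (h0 : 0 ≤ h) (h1 : h ≤ 1) (hx : 0 < x) (hy : 0 < y)
    (p q : ℝ) :
    ENNReal.ofReal (h * (x ^ p * y ^ q)) ^ 2 ≤ ENNReal.ofReal (x ^ (2 * p) * y ^ (2 * q)) := by
  rw [← ENNReal.ofReal_pow (by positivity), mul_comm 2 p, mul_comm 2 q, Real.rpow_mul hx.le,
    Real.rpow_mul hy.le, Real.rpow_two, Real.rpow_two, ← mul_pow]
  refine ENNReal.ofReal_le_ofReal (pow_le_pow_left₀ (by positivity) ?_ 2)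
  exact mul_le_of_le_one_left (by positivity) h1

/-- Exponents for the kernel bounds: with `1/3 < 2b`, there is room for a decay `γ > 1/3`. -/
lemma exists_decay_exponent {b : ℝ} (hb : 1 / 6 < b) (hb' : b ≤ 1 / 2) :
    ∃ γ : ℝ, 1 / 3 < γ ∧ γ ≤ 2 * b ∧ γ ≤ 1 ∧ 1 < 2 * b + 1 - γ :=
  ⟨(2 * b + 1 / 3) / 2, by linarith, by linarith, by linarith, by linarith⟩

/-- The trilinear bookkeeping shared by both estimates: if the multiplier gains half a power of one
of the moduli `A`, `A₁`, `A₂`, the weighted product is controlled by three terms, in each of which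
one modulus has been cancelled. A coefficient `h₁` or `h₂` equal to `0` switches a term off. -/
lemma weighted_product_le {m j₁ j₂ A A₁ A₂ u v C b : ℝ} (hj₁ : 0 < j₁) (hj₂ : 0 < j₂)
    (hA : 0 < A) (hA₁ : 0 < A₁) (hA₂ : 0 < A₂) (hu : 0 ≤ u) (hv : 0 ≤ v) (h₁ h₂ : ℝ)
    (hM : m * (j₁ * j₂)⁻¹ ≤ C * (h₁ * A ^ (1 / 2 : ℝ) + A₁ ^ (1 / 2 : ℝ) + h₂ * A₂ ^ (1 / 2 : ℝ))) :
    m * A ^ (-1 / 2 : ℝ) * (u * v) ≤ C * (h₁ * (A₁ ^ (-b) * A₂ ^ (-1 / 2 : ℝ)) *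
        (j₁ * A₁ ^ b * u * (j₂ * A₂ ^ (1 / 2 : ℝ) * v)) +
      A ^ (-1 / 2 : ℝ) * A₂ ^ (-b) * (j₁ * A₁ ^ (1 / 2 : ℝ) * u * (j₂ * A₂ ^ b * v)) +
      h₂ * (A ^ (-1 / 2 : ℝ) * A₁ ^ (-b)) * (j₁ * A₁ ^ b * u * (j₂ * A₂ ^ (1 / 2 : ℝ) * v))) := by
  have inv : ∀ {X : ℝ} (c : ℝ), 0 < X → X ^ (-c) * X ^ c = 1 := fun c hX => by
    rw [← Real.rpow_add hX, neg_add_cancel, Real.rpow_zero]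
  have eA := inv (1 / 2) hA
  have eA₁ := inv b hA₁
  have eA₂ := inv (1 / 2) hA₂
  have eA₂' := inv b hA₂
  rw [neg_div]
  have hpos : 0 ≤ j₁ * j₂ * A ^ (-(1 / 2) : ℝ) * (u * v) := by positivity
  have h := mul_le_mul_of_nonneg_right hM hpos
  have hL : m * (j₁ * j₂)⁻¹ * (j₁ * j₂ * A ^ (-(1 / 2) : ℝ) * (u * v)) =
      m * A ^ (-(1 / 2) : ℝ) * (u * v) := by field_simp
  rw [hL] at h
  refine h.trans_eq ?_
  linear_combination C * j₁ * j₂ * u * v * (h₁ * eA - h₁ * A₁ ^ (-b) * A₁ ^ b * eA₂ - h₁ * eA₁ -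
    A ^ (-(1 / 2) : ℝ) * A₁ ^ (1 / 2 : ℝ) * eA₂' - h₂ * A ^ (-(1 / 2) : ℝ) * A₂ ^ (1 / 2 : ℝ) * eA₁)

lemma ofReal_weighted_product_le {m j₁ j₂ A A₁ A₂ u v C h₁ h₂ b : ℝ} (hm : 0 ≤ m) (hj₁ : 0 < j₁)
    (hj₂ : 0 < j₂) (hA : 0 < A) (hA₁ : 0 < A₁) (hA₂ : 0 < A₂) (hu : 0 ≤ u) (hv : 0 ≤ v)
    (hC : 0 ≤ C) (hh₁ : 0 ≤ h₁) (hh₂ : 0 ≤ h₂)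
    (hM : m * (j₁ * j₂)⁻¹ ≤ C * (h₁ * A ^ (1 / 2 : ℝ) + A₁ ^ (1 / 2 : ℝ) + h₂ * A₂ ^ (1 / 2 : ℝ))) :
    ENNReal.ofReal (m * A ^ (-1 / 2 : ℝ)) * (ENNReal.ofReal u * ENNReal.ofReal v) ≤
      ENNReal.ofReal C * (ENNReal.ofReal (h₁ * (A₁ ^ (-b) * A₂ ^ (-1 / 2 : ℝ))) *
        (ENNReal.ofReal (j₁ * A₁ ^ b * u) * ENNReal.ofReal (j₂ * A₂ ^ (1 / 2 : ℝ) * v)) +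
      ENNReal.ofReal (A ^ (-1 / 2 : ℝ) * A₂ ^ (-b)) *
        (ENNReal.ofReal (j₁ * A₁ ^ (1 / 2 : ℝ) * u) * ENNReal.ofReal (j₂ * A₂ ^ b * v)) +
      ENNReal.ofReal (h₂ * (A ^ (-1 / 2 : ℝ) * A₁ ^ (-b))) *
        (ENNReal.ofReal (j₁ * A₁ ^ b * u) * ENNReal.ofReal (j₂ * A₂ ^ (1 / 2 : ℝ) * v))) := by
  have h := weighted_product_le (b := b) hj₁ hj₂ hA hA₁ hA₂ hu hv h₁ h₂ hM
  repeat rw [← ENNReal.ofReal_mul (by positivity)]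
  repeat rw [← ENNReal.ofReal_add (by positivity) (by positivity)]
  rw [← ENNReal.ofReal_mul hC]
  exact ENNReal.ofReal_le_ofReal h

/-- The convolution of the absolute values. -/
noncomputable def convNorm (U N : ℤ × ℝ → ℂ) (x : ℤ × ℝ) : ℝ≥0∞ :=
  ∫⁻ y, ‖U y‖ₑ * ‖N (x - y)‖ₑ ∂freqMeasure

lemma measurable_convNorm {U N : ℤ × ℝ → ℂ} (hU : Measurable U) (hN : Measurable N) :
    Measurable (convNorm U N) :=
  Measurable.lintegral_prod_right' (f := fun p : (ℤ × ℝ) × (ℤ × ℝ) => ‖U p.2‖ₑ * ‖N (p.1 - p.2)‖ₑ)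
    (by fun_prop)

/-- The estimate for `u n`. The three kernels correspond to the largest modulation being that of
the output, of `u` and of `n`. When `n` has spatial frequency `0` the multiplier is `1`, and the
first kernel suffices: this keeps the third one away from the degenerate phase. -/
lemma exists_schrodinger_estimate {α β ε s l b : ℝ} (hα : 0 < α) (hβ : 0 < β) (hε : 0 < ε)
    (hs : 0 ≤ s) (hl : -1 ≤ l) (hsl : s - l ≤ 2) (hb : 1 / 6 < b) (hb' : b ≤ 1 / 2) :
    ∃ D : ℝ, 0 < D ∧ ∀ U N : ℤ × ℝ → ℂ, Measurable U → Measurable N →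
      ∫⁻ x, (ENNReal.ofReal (jap (x.1 : ℝ) ^ s * modS α ε x ^ (-1 / 2 : ℝ)) *
          convNorm U N x) ^ 2 ∂freqMeasure ≤
        ENNReal.ofReal D *
          ((∫⁻ x, weighted (phaseS α ε) s b U x ^ 2 ∂freqMeasure) *
              (∫⁻ x, weighted (phaseW β ε) l (1 / 2) N x ^ 2 ∂freqMeasure) +
            (∫⁻ x, weighted (phaseS α ε) s (1 / 2) U x ^ 2 ∂freqMeasure) *
              ∫⁻ x, weighted (phaseW β ε) l b N x ^ 2 ∂freqMeasure) := by
  obtain ⟨γ, hγ, hγb, hγ1, hγr⟩ := exists_decay_exponent hb hb'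
  obtain ⟨C, hC, HM⟩ := exists_schrodinger_multiplier_le hα hβ hε hs hl hsl
  obtain ⟨B₁, hB₁, H₁⟩ := exists_lintegral_modS_modW_le (α := α) hβ hε hγ hγb hγ1 hγr
  obtain ⟨B₂, hB₂, H₂⟩ := exists_lintegral_modS_modW_le (α := α) hβ hε hγ hγ1 hγb
    (by linarith : 1 < 1 + 2 * b - γ)
  obtain ⟨B₃, hB₃, H₃⟩ := exists_lintegral_modS_modS_le hα hε hγ hγb hγ1 hγr
  refine ⟨(C + 1) ^ 2 * (16 * (B₁ + B₂ + B₃)), by positivity, fun U N hU hN => ?_⟩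
  set h₂ : ℤ × ℝ → ℝ := fun z => if z.1 = 0 then 0 else 1 with hh₂
  have hh₂0 : ∀ z, 0 ≤ h₂ z := fun z => by simp only [hh₂]; split_ifs <;> norm_num
  have hh₂1 : ∀ z, h₂ z ≤ 1 := fun z => by simp only [hh₂]; split_ifs <;> norm_num
  have hh₂m : Measurable h₂ :=
    Measurable.ite (measurableSet_eq_fun measurable_fst measurable_const) (by fun_prop)
      (by fun_prop)
  have hlhs : ∀ x : ℤ × ℝ, ENNReal.ofReal (jap (x.1 : ℝ) ^ s * modS α ε x ^ (-1 / 2 : ℝ)) *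
      convNorm U N x = ∫⁻ y, ENNReal.ofReal (jap (x.1 : ℝ) ^ s * modS α ε x ^ (-1 / 2 : ℝ)) *
        (‖U y‖ₑ * ‖N (x - y)‖ₑ) ∂freqMeasure := fun x => by
    rw [lintegral_const_mul _ (by fun_prop), convNorm]
  simp_rw [hlhs]
  have hD : ENNReal.ofReal ((C + 1) ^ 2 * (16 * (B₁ + B₂ + B₃))) =
      ENNReal.ofReal (C + 1) ^ 2 *
        (16 * (ENNReal.ofReal B₁ + ENNReal.ofReal B₂ + ENNReal.ofReal B₃)) := by
    rw [ENNReal.ofReal_mul (by positivity), ENNReal.ofReal_mul (by norm_num),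
      ENNReal.ofReal_pow (by positivity), ENNReal.ofReal_add (by positivity) hB₃.le,
      ENNReal.ofReal_add hB₁.le hB₂.le]
    norm_num
  rw [hD]
  refine lintegral_sq_le_of_three_kernels
    (K₁ := fun x y => ENNReal.ofReal (1 * (modS α ε y ^ (-b) * modW β ε (x - y) ^ (-1 / 2 : ℝ))))
    (K₂ := fun x y => ENNReal.ofReal (modS α ε x ^ (-1 / 2 : ℝ) * modW β ε (x - y) ^ (-b)))
    (K₃ := fun x y => ENNReal.ofReal
      (h₂ (x - y) * (modS α ε x ^ (-1 / 2 : ℝ) * modS α ε y ^ (-b))))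
    (measurable_weighted (measurable_phaseS α ε) s b hU)
    (measurable_weighted (measurable_phaseS α ε) s (1 / 2) hU)
    (measurable_weighted (measurable_phaseW β ε) l b hN)
    (measurable_weighted (measurable_phaseW β ε) l (1 / 2) hN)
    (by unfold Function.uncurry; fun_prop) (by unfold Function.uncurry; fun_prop)
    (by unfold Function.uncurry; fun_prop) (fun x => ?_) (fun y => ?_) (fun z => ?_) fun x y => ?_
  · refine (lintegral_mono fun y => ?_).trans (H₁ x)
    refine (ofReal_kernel_sq_le zero_le_one le_rfl (modS_pos _ _ _) (modW_pos _ _ _) _ _).trans_eq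
      ?_
    ring_nf
  · refine (lintegral_mono fun x => ?_).trans (H₂ y)
    rw [← one_mul (modS α ε x ^ (-1 / 2 : ℝ) * _)]
    refine (ofReal_kernel_sq_le zero_le_one le_rfl (modS_pos _ _ _) (modW_pos _ _ _) _ _).trans_eq
      ?_
    rw [← modW_neg, neg_sub]
    ring_nf
  · by_cases hz : z.1 = 0
    · simp [hh₂, hz]
    · refine (lintegral_mono fun y => ?_).trans (H₃ z hz)
      refine (ofReal_kernel_sq_le (hh₂0 _) (hh₂1 _) (modS_pos _ _ _) (modS_pos _ _ _) _ _).trans_eq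
        ?_
      ring_nf
  · rw [← ofReal_norm, ← ofReal_norm]
    refine ofReal_weighted_product_le (Real.rpow_nonneg (jap_pos _).le _)
      (Real.rpow_pos_of_pos (jap_pos _) _) (Real.rpow_pos_of_pos (jap_pos _) _) (modS_pos _ _ _)
      (modS_pos _ _ _) (modW_pos _ _ _) (norm_nonneg _) (norm_nonneg _) (by positivity)
      zero_le_one (hh₂0 _) ?_
    have hA := Real.rpow_nonneg (modS_pos α ε x).le (1 / 2)
    have hA' := Real.one_le_rpow (one_le_modS α ε x) (show (0 : ℝ) ≤ 1 / 2 by norm_num)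
    have hA₁ := Real.rpow_nonneg (modS_pos α ε y).le (1 / 2)
    have hA₂ := Real.rpow_nonneg (modW_pos β ε (x - y)).le (1 / 2)
    rw [mul_inv, ← Real.rpow_neg (jap_pos _).le, ← Real.rpow_neg (jap_pos _).le, ← mul_assoc]
    simp only [hh₂]
    split_ifs with hz
    · have hz' : x.1 = y.1 := sub_eq_zero.1 hz
      rw [hz', hz, Int.cast_zero, jap_zero, Real.one_rpow, mul_one, ← Real.rpow_add (jap_pos _),
        add_neg_cancel, Real.rpow_zero]
      nlinarith
    · have h1 := HM x.1 y.1 x.2 y.2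
      have h2 : modSum α β ε x.1 y.1 x.2 y.2 ^ (1 / 2 : ℝ) ≤ modS α ε x ^ (1 / 2 : ℝ) +
          modS α ε y ^ (1 / 2 : ℝ) + modW β ε (x - y) ^ (1 / 2 : ℝ) :=
        (add_rpow_half_le (add_pos (modS_pos α ε x) (modS_pos α ε y)).le
          (modW_pos β ε (x - y)).le).trans
          (add_le_add_left (add_rpow_half_le (modS_pos α ε x).le (modS_pos α ε y).le) _)
      rw [Prod.fst_sub, Int.cast_sub, one_mul, one_mul]
      refine h1.trans ?_
      nlinarith

/-- The estimate for `D^ρ (u v̄)`, where `V` is the Fourier transform of `v`. The symbol of `D^ρ`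
vanishes at the spatial frequency `0` of the output, so that two Schrödinger waves with the same
spatial frequency never meet in the first kernel. -/
lemma exists_wave_estimate {α β ε ρ s l b : ℝ} (hα : 0 < α) (hβ : 0 < β) (hε : 0 < ε)
    (hρ : 0 < ρ) (hs : 0 ≤ s) (hl : l ≤ 2 * s + 1 - ρ) (hsl : -2 + ρ ≤ s - l)
    (hb : 1 / 6 < b) (hb' : b ≤ 1 / 2) :
    ∃ D : ℝ, 0 < D ∧ ∀ U V : ℤ × ℝ → ℂ, Measurable U → Measurable V →
      ∫⁻ x, (ENNReal.ofReal (|(x.1 : ℝ)| ^ ρ * jap (x.1 : ℝ) ^ l * modW β ε x ^ (-1 / 2 : ℝ)) *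
          convNorm U (fun z => conj (V (-z))) x) ^ 2 ∂freqMeasure ≤
        ENNReal.ofReal D *
          ((∫⁻ x, weighted (phaseS α ε) s b U x ^ 2 ∂freqMeasure) *
              (∫⁻ x, weighted (phaseS α ε) s (1 / 2) V x ^ 2 ∂freqMeasure) +
            (∫⁻ x, weighted (phaseS α ε) s (1 / 2) U x ^ 2 ∂freqMeasure) *
              ∫⁻ x, weighted (phaseS α ε) s b V x ^ 2 ∂freqMeasure) := by
  obtain ⟨γ, hγ, hγb, hγ1, hγr⟩ := exists_decay_exponent hb hb'
  obtain ⟨C, hC, HM⟩ := exists_wave_multiplier_le hα hβ hε hρ hs hl hsl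
  obtain ⟨B₁, hB₁, H₁⟩ := exists_lintegral_modS_modS_le hα hε hγ hγb hγ1 hγr
  obtain ⟨B₂, hB₂, H₂⟩ := exists_lintegral_modS_modW_le (α := α) hβ hε hγ hγb hγ1 hγr
  refine ⟨C ^ 2 * (16 * (B₁ + B₂ + B₂)), by positivity, fun U V hU hV => ?_⟩
  set h₁ : ℤ × ℝ → ℝ := fun z => if z.1 = 0 then 0 else 1 with hh₁
  have hh₁0 : ∀ z, 0 ≤ h₁ z := fun z => by simp only [hh₁]; split_ifs <;> norm_num
  have hh₁1 : ∀ z, h₁ z ≤ 1 := fun z => by simp only [hh₁]; split_ifs <;> norm_num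
  have hh₁m : Measurable h₁ :=
    Measurable.ite (measurableSet_eq_fun measurable_fst measurable_const) (by fun_prop)
      (by fun_prop)
  have hlhs : ∀ x : ℤ × ℝ,
      ENNReal.ofReal (|(x.1 : ℝ)| ^ ρ * jap (x.1 : ℝ) ^ l * modW β ε x ^ (-1 / 2 : ℝ)) *
      convNorm U (fun z => conj (V (-z))) x =
      ∫⁻ y, ENNReal.ofReal (|(x.1 : ℝ)| ^ ρ * jap (x.1 : ℝ) ^ l * modW β ε x ^ (-1 / 2 : ℝ)) *
        (‖U y‖ₑ * ‖V (y - x)‖ₑ) ∂freqMeasure := fun x => by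
    rw [lintegral_const_mul _ (by fun_prop), convNorm]
    simp
  simp_rw [hlhs]
  have hD : ENNReal.ofReal (C ^ 2 * (16 * (B₁ + B₂ + B₂))) =
      ENNReal.ofReal C ^ 2 *
        (16 * (ENNReal.ofReal B₁ + ENNReal.ofReal B₂ + ENNReal.ofReal B₂)) := by
    rw [ENNReal.ofReal_mul (by positivity), ENNReal.ofReal_mul (by norm_num),
      ENNReal.ofReal_pow (by positivity), ENNReal.ofReal_add (by positivity) hB₂.le,
      ENNReal.ofReal_add hB₁.le hB₂.le]
    norm_num
  rw [hD, ← lintegral_neg_eq_self (fun x => weighted (phaseS α ε) s (1 / 2) V x ^ 2),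
    ← lintegral_neg_eq_self (fun x => weighted (phaseS α ε) s b V x ^ 2)]
  refine lintegral_sq_le_of_three_kernels
    (K₁ := fun x y => ENNReal.ofReal
      (h₁ x * (modS α ε y ^ (-b) * modS α ε (y - x) ^ (-1 / 2 : ℝ))))
    (K₂ := fun x y => ENNReal.ofReal (modW β ε x ^ (-1 / 2 : ℝ) * modS α ε (y - x) ^ (-b)))
    (K₃ := fun x y => ENNReal.ofReal
      (1 * (modW β ε x ^ (-1 / 2 : ℝ) * modS α ε y ^ (-b))))
    (measurable_weighted (measurable_phaseS α ε) s b hU)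
    (measurable_weighted (measurable_phaseS α ε) s (1 / 2) hU)
    ((measurable_weighted (measurable_phaseS α ε) s b hV).comp measurable_neg)
    ((measurable_weighted (measurable_phaseS α ε) s (1 / 2) hV).comp measurable_neg)
    (by unfold Function.uncurry; fun_prop) (by unfold Function.uncurry; fun_prop)
    (by unfold Function.uncurry; fun_prop) (fun x => ?_) (fun y => ?_) (fun z => ?_) fun x y => ?_
  · by_cases hx : x.1 = 0
    · simp [hh₁, hx]
    · refine (lintegral_mono fun y => ?_).trans (H₁ (-x) (by simpa using hx))
      refine (ofReal_kernel_sq_le (hh₁0 _) (hh₁1 _) (modS_pos _ _ _) (modS_pos _ _ _) _ _).trans_eq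
        ?_
      rw [← sub_eq_add_neg]
      ring_nf
  · rw [← lintegral_sub_left_eq_self _ y]
    refine (lintegral_mono fun x => ?_).trans (H₂ y)
    simp only [sub_sub_cancel]
    rw [← one_mul (modW β ε (y - x) ^ (-1 / 2 : ℝ) * _), mul_comm (modW β ε (y - x) ^ (-1 / 2 : ℝ))]
    refine (ofReal_kernel_sq_le zero_le_one le_rfl (modS_pos _ _ _) (modW_pos _ _ _) _ _).trans_eq
      ?_
    ring_nf
  · refine (lintegral_mono fun y => ?_).trans (H₂ (-z))
    simp only []
    rw [mul_comm (modW β ε (y + z) ^ (-1 / 2 : ℝ))]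
    refine (ofReal_kernel_sq_le zero_le_one le_rfl (modS_pos _ _ _) (modW_pos _ _ _) _ _).trans_eq
      ?_
    rw [← modW_neg, neg_add', sub_eq_add_neg, add_comm, ← sub_eq_add_neg]
    ring_nf
  · rw [← ofReal_norm, ← ofReal_norm]
    simp only [neg_sub]
    refine ofReal_weighted_product_le
      (mul_nonneg (by positivity) (Real.rpow_nonneg (jap_pos _).le _))
      (Real.rpow_pos_of_pos (jap_pos _) _) (Real.rpow_pos_of_pos (jap_pos _) _) (modW_pos _ _ _)
      (modS_pos _ _ _) (modS_pos _ _ _) (norm_nonneg _) (norm_nonneg _) hC.le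
      (hh₁0 _) zero_le_one ?_
    have hA := Real.rpow_nonneg (modW_pos β ε x).le (1 / 2)
    have hA₁ := Real.rpow_nonneg (modS_pos α ε y).le (1 / 2)
    have hA₂ := Real.rpow_nonneg (modS_pos α ε (y - x)).le (1 / 2)
    rw [mul_inv, ← Real.rpow_neg (jap_pos _).le, ← Real.rpow_neg (jap_pos _).le, ← mul_assoc]
    simp only [hh₁]
    split_ifs with hx
    · rw [hx, Int.cast_zero, abs_zero, Real.zero_rpow hρ.ne']
      simp only [zero_mul]
      positivity
    · have h1 := HM y.1 (y - x).1 y.2 (y - x).2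
      have hd : ((y.1 : ℝ) - ((y - x).1 : ℤ)) = x.1 := by
        rw [Prod.fst_sub, Int.cast_sub, sub_sub_cancel]
      rw [hd] at h1
      have h2 : modSum α β ε y.1 (y - x).1 y.2 (y - x).2 ^ (1 / 2 : ℝ) ≤
          modS α ε y ^ (1 / 2 : ℝ) + modS α ε (y - x) ^ (1 / 2 : ℝ) + modW β ε x ^ (1 / 2 : ℝ) := by
        have h3 : modSum α β ε y.1 (y - x).1 y.2 (y - x).2 ^ (1 / 2 : ℝ) ≤
            modS α ε y ^ (1 / 2 : ℝ) +
            modS α ε (y - x) ^ (1 / 2 : ℝ) + modW β ε (y - (y - x)) ^ (1 / 2 : ℝ) :=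
          (add_rpow_half_le (add_pos (modS_pos α ε y) (modS_pos α ε (y - x))).le
            (modW_pos β ε (y - (y - x))).le).trans
            (add_le_add_left (add_rpow_half_le (modS_pos α ε y).le (modS_pos α ε (y - x)).le) _)
        rwa [sub_sub_cancel] at h3
      refine h1.trans (mul_le_mul_of_nonneg_left (h2.trans_eq ?_) hC.le)
      ring

/-! ### From measurable functions to elements of the Bourgain spaces -/

/-- The convolution of the absolute values, in the form used by `ConvAbs`. -/
noncomputable def convAbs (F G : ℤ → ℝ → ℂ) (k : ℤ) (τ : ℝ) : ℝ≥0∞ :=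
  ∑' k₁ : ℤ, ∫⁻ τ₁ : ℝ, ‖F k₁ τ₁‖ₑ * ‖G (k - k₁) (τ - τ₁)‖ₑ

lemma measurable_uncurry {F : ℤ → ℝ → ℂ} (hF : ∀ k, Measurable (F k)) :
    Measurable fun x : ℤ × ℝ => F x.1 x.2 :=
  measurable_of_forall_section hF

lemma convAbs_eq_convNorm {F G : ℤ → ℝ → ℂ} (hF : ∀ k, Measurable (F k))
    (hG : ∀ k, Measurable (G k)) (x : ℤ × ℝ) :
    convAbs F G x.1 x.2 = convNorm (fun x => F x.1 x.2) (fun x => G x.1 x.2) x := by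
  have h1 := measurable_uncurry hF
  have h2 := measurable_uncurry hG
  have h3 : Measurable fun y : ℤ × ℝ => G (x - y).1 (x - y).2 :=
    h2.comp (by fun_prop : Measurable fun y : ℤ × ℝ => x - y)
  rw [convNorm, lintegral_freqMeasure (by exact h1.enorm.mul h3.enorm)]
  rfl

lemma weightedNorm_eq {φ : ℤ → ℝ → ℝ} (hφ : Measurable fun x : ℤ × ℝ => φ x.1 x.2) (s b : ℝ)
    {F : ℤ → ℝ → ℂ} (hF : ∀ k, Measurable (F k)) :
    weightedNorm φ s b F =
      (∫⁻ x, weighted φ s b (fun x => F x.1 x.2) x ^ 2 ∂freqMeasure) ^ (1 / 2 : ℝ) := by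
  rw [lintegral_freqMeasure ((measurable_weighted hφ s b (measurable_uncurry hF)).pow_const 2)]
  rfl

lemma weightedNorm_congr_ae (φ : ℤ → ℝ → ℝ) (s b : ℝ) {F F' : ℤ → ℝ → ℂ}
    (h : ∀ k, F k =ᵐ[volume] F' k) : weightedNorm φ s b F = weightedNorm φ s b F' := by
  unfold weightedNorm
  congr 1
  refine tsum_congr fun k => lintegral_congr_ae ?_
  filter_upwards [h k] with τ hτ
  rw [hτ]

lemma weightedNorm_mono_right (φ : ℤ → ℝ → ℝ) (s : ℝ) {b b' : ℝ} (h : b ≤ b') (F : ℤ → ℝ → ℂ) :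
    weightedNorm φ s b F ≤ weightedNorm φ s b' F := by
  unfold weightedNorm
  gcongr with k τ
  · exact Real.rpow_nonneg (jap_pos _).le _
  · exact one_le_jap _

lemma ae_eq_comp_sub_left {f g : ℝ → ℂ} (h : f =ᵐ[volume] g) (τ : ℝ) :
    (fun t => f (τ - t)) =ᵐ[volume] fun t => g (τ - t) :=
  (quasiMeasurePreserving_sub_left volume τ).ae_eq_comp h

lemma convAbs_congr_ae {F F' G G' : ℤ → ℝ → ℂ} (hF : ∀ k, F k =ᵐ[volume] F' k)
    (hG : ∀ k, G k =ᵐ[volume] G' k) (k : ℤ) (τ : ℝ) : convAbs F G k τ = convAbs F' G' k τ := by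
  refine tsum_congr fun k₁ => lintegral_congr_ae ?_
  filter_upwards [hF k₁, ae_eq_comp_sub_left (hG (k - k₁)) τ] with t h1 h2
  rw [h1, h2]

lemma conv_congr_ae {F F' G G' : ℤ → ℝ → ℂ} (hF : ∀ k, F k =ᵐ[volume] F' k)
    (hG : ∀ k, G k =ᵐ[volume] G' k) : conv F G = conv F' G' := by
  funext k τ
  refine tsum_congr fun k₁ => integral_congr_ae ?_
  filter_upwards [hF k₁, ae_eq_comp_sub_left (hG (k - k₁)) τ] with t h1 h2
  rw [h1, h2]

lemma conjFT_congr_ae {F F' : ℤ → ℝ → ℂ} (hF : ∀ k, F k =ᵐ[volume] F' k) (k : ℤ) :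
    conjFT F k =ᵐ[volume] conjFT F' k := by
  have hq := (Measure.measurePreserving_neg (volume : Measure ℝ)).quasiMeasurePreserving
  filter_upwards [hq.ae_eq_comp (hF (-k))] with t ht
  simp only [conjFT]
  exact congrArg _ ht

lemma enorm_integral_mul_le (F G : ℤ → ℝ → ℂ) (k k₁ : ℤ) (τ : ℝ) :
    ‖∫ τ₁ : ℝ, F k₁ τ₁ * G (k - k₁) (τ - τ₁)‖ₑ ≤
      ∫⁻ τ₁ : ℝ, ‖F k₁ τ₁‖ₑ * ‖G (k - k₁) (τ - τ₁)‖ₑ :=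
  (enorm_integral_le_lintegral_enorm _).trans_eq (by simp_rw [enorm_mul])

lemma enorm_conv_le (F G : ℤ → ℝ → ℂ) (k : ℤ) (τ : ℝ) : ‖conv F G k τ‖ₑ ≤ convAbs F G k τ :=
  enorm_tsum_le_tsum_enorm.trans (ENNReal.tsum_le_tsum fun k₁ => enorm_integral_mul_le F G k k₁ τ)

lemma aestronglyMeasurable_conv {F G : ℤ → ℝ → ℂ} (hF : ∀ k, Measurable (F k))
    (hG : ∀ k, Measurable (G k)) {k : ℤ} (h : ∀ᵐ τ : ℝ, ConvAbs F G k τ) :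
    AEStronglyMeasurable (conv F G k) volume := by
  have hm : ∀ k₁ : ℤ, StronglyMeasurable
      fun τ : ℝ => ∫ τ₁ : ℝ, F k₁ τ₁ * G (k - k₁) (τ - τ₁) := fun k₁ => by
    have h1 := hF k₁
    have h2 := hG (k - k₁)
    have h3 : Measurable fun p : ℝ × ℝ => F k₁ p.2 * G (k - k₁) (p.1 - p.2) := by fun_prop
    exact h3.stronglyMeasurable.integral_prod_right'
  refine aestronglyMeasurable_of_tendsto_ae (u := Filter.atTop (α := Finset ℤ))
    (f := fun S τ => ∑ k₁ ∈ S, ∫ τ₁ : ℝ, F k₁ τ₁ * G (k - k₁) (τ - τ₁))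
    (fun S => (Finset.stronglyMeasurable_fun_sum S fun k₁ _ => hm k₁).aestronglyMeasurable) ?_
  filter_upwards [h] with τ hτ
  refine Summable.hasSum (Summable.of_nnnorm ?_)
  rw [← ENNReal.tsum_coe_ne_top_iff_summable]
  exact ((ENNReal.tsum_le_tsum fun k₁ => enorm_integral_mul_le F G k k₁ τ).trans_lt hτ).ne

lemma ennreal_sqrt_mul_le (D : ℝ) (hD : 0 ≤ D) (X Y Z W : ℝ≥0∞) :
    (ENNReal.ofReal D * (X * Y + Z * W)) ^ (1 / 2 : ℝ) ≤ ENNReal.ofReal (D ^ (1 / 2 : ℝ)) *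
      (X ^ (1 / 2 : ℝ) * Y ^ (1 / 2 : ℝ) + Z ^ (1 / 2 : ℝ) * W ^ (1 / 2 : ℝ)) := by
  have h0 : (0 : ℝ) ≤ 1 / 2 := by norm_num
  rw [ENNReal.mul_rpow_of_nonneg _ _ h0, ENNReal.ofReal_rpow_of_nonneg hD h0,
    ← ENNReal.mul_rpow_of_nonneg _ _ h0, ← ENNReal.mul_rpow_of_nonneg _ _ h0]
  gcongr
  exact ENNReal.rpow_add_le_add_rpow _ _ h0 (by norm_num)

/-- A bound on the weighted convolution of absolute values bounds the weighted norm. -/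
lemma weightedNorm_le_of_convAbs {φ : ℤ → ℝ → ℝ} {s b : ℝ} {F G H : ℤ → ℝ → ℂ} {w : ℤ × ℝ → ℝ}
    (hF : ∀ k, Measurable (F k)) (hG : ∀ k, Measurable (G k)) (hw : Measurable w)
    (h : ∀ (k : ℤ) (τ : ℝ), ENNReal.ofReal (jap (k : ℝ) ^ s * jap (φ k τ) ^ b * ‖H k τ‖) ≤
      ENNReal.ofReal (w (k, τ)) * convAbs F G k τ) :
    weightedNorm φ s b H ≤ (∫⁻ x, (ENNReal.ofReal (w x) *
      convNorm (fun x => F x.1 x.2) (fun x => G x.1 x.2) x) ^ 2 ∂freqMeasure) ^ (1 / 2 : ℝ) := by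
  have hm := measurable_convNorm (measurable_uncurry hF) (measurable_uncurry hG)
  rw [lintegral_freqMeasure (by fun_prop)]
  unfold weightedNorm
  gcongr with k τ
  rw [← convAbs_eq_convNorm hF hG]
  exact h k τ

lemma exists_measurable_rep {F : ℤ → ℝ → ℂ} (hF : ∀ k, AEStronglyMeasurable (F k) volume) :
    ∃ F' : ℤ → ℝ → ℂ, (∀ k, Measurable (F' k)) ∧ ∀ k, F k =ᵐ[volume] F' k :=
  ⟨fun k => (hF k).mk, fun k => (hF k).stronglyMeasurable_mk.measurable, fun k => (hF k).ae_eq_mk⟩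

lemma ofReal_mul_norm (a : ℝ) (ha : 0 ≤ a) (z : ℂ) :
    ENNReal.ofReal (a * ‖z‖) = ENNReal.ofReal a * ‖z‖ₑ := by
  rw [ENNReal.ofReal_mul ha, ofReal_norm]

/-- The estimate for `u n` in the Bourgain spaces. -/
theorem exists_schrodinger_conv_estimate {α β ε s l b : ℝ} (hα : 0 < α) (hβ : 0 < β) (hε : 0 < ε)
    (hs : 0 ≤ s) (hl : -1 ≤ l) (hsl : s - l ≤ 2) (hb : 1 / 6 < b) (hb' : b ≤ 1 / 2) :
    ∃ C : ℝ, 0 < C ∧ ∀ U N : ℤ → ℝ → ℂ, MemXS α ε s (1 / 2) U → MemXW β ε l (1 / 2) N →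
      (∀ k, ∀ᵐ τ : ℝ, ConvAbs U N k τ) ∧ MemXS α ε s (-1 / 2) (conv U N) ∧
      normS α ε s (-1 / 2) (conv U N) ≤ ENNReal.ofReal C *
        (normS α ε s b U * normW β ε l (1 / 2) N + normS α ε s (1 / 2) U * normW β ε l b N) := by
  obtain ⟨D, hD, H⟩ := exists_schrodinger_estimate hα hβ hε hs hl hsl hb hb'
  refine ⟨D ^ (1 / 2 : ℝ), by positivity, fun U N ⟨hUm, hUn⟩ ⟨hNm, hNn⟩ => ?_⟩
  obtain ⟨U', hU', hUU'⟩ := exists_measurable_rep hUm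
  obtain ⟨N', hN', hNN'⟩ := exists_measurable_rep hNm
  have hfin : normS α ε s b U * normW β ε l (1 / 2) N +
      normS α ε s (1 / 2) U * normW β ε l b N < ∞ :=
    ENNReal.add_lt_top.2 ⟨ENNReal.mul_lt_top ((weightedNorm_mono_right _ _ hb' _).trans_lt hUn) hNn,
      ENNReal.mul_lt_top hUn ((weightedNorm_mono_right _ _ hb' _).trans_lt hNn)⟩
  have hw : Measurable fun x : ℤ × ℝ => jap (x.1 : ℝ) ^ s * modS α ε x ^ (-1 / 2 : ℝ) := by
    fun_prop
  have hwpos : ∀ x : ℤ × ℝ, 0 < jap (x.1 : ℝ) ^ s * modS α ε x ^ (-1 / 2 : ℝ) := fun x =>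
    mul_pos (Real.rpow_pos_of_pos (jap_pos _) _) (Real.rpow_pos_of_pos (modS_pos _ _ _) _)
  have hmain : (∫⁻ x, (ENNReal.ofReal (jap (x.1 : ℝ) ^ s * modS α ε x ^ (-1 / 2 : ℝ)) *
      convNorm (fun x => U' x.1 x.2) (fun x => N' x.1 x.2) x) ^ 2 ∂freqMeasure) ^ (1 / 2 : ℝ) ≤
      ENNReal.ofReal (D ^ (1 / 2 : ℝ)) * (normS α ε s b U * normW β ε l (1 / 2) N +
        normS α ε s (1 / 2) U * normW β ε l b N) := by
    simp only [normS, normW]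
    rw [weightedNorm_congr_ae _ _ _ hUU', weightedNorm_congr_ae _ _ _ hUU',
      weightedNorm_congr_ae _ _ _ hNN', weightedNorm_congr_ae _ _ _ hNN',
      weightedNorm_eq (measurable_phaseS α ε) _ _ hU',
      weightedNorm_eq (measurable_phaseS α ε) _ _ hU',
      weightedNorm_eq (measurable_phaseW β ε) _ _ hN',
      weightedNorm_eq (measurable_phaseW β ε) _ _ hN']
    refine le_trans ?_ (ennreal_sqrt_mul_le D hD.le _ _ _ _)
    gcongr
    exact H _ _ (measurable_uncurry hU') (measurable_uncurry hN')
  have hmainfin := hmain.trans_lt (ENNReal.mul_lt_top ENNReal.ofReal_lt_top hfin)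
  have hm := measurable_convNorm (measurable_uncurry hU') (measurable_uncurry hN')
  have hae : ∀ k, ∀ᵐ τ : ℝ, convAbs U' N' k τ < ∞ := by
    intro k
    have h1 := (ENNReal.rpow_lt_top_iff_of_pos (by norm_num)).1 hmainfin
    rw [lintegral_freqMeasure (by fun_prop)] at h1
    have h2 := ae_lt_top (by fun_prop) (ENNReal.ne_top_of_tsum_ne_top h1.ne k)
    filter_upwards [h2] with τ hτ
    rw [← convAbs_eq_convNorm hU' hN' (k, τ)] at hτ
    by_contra htop
    rw [not_lt_top_iff] at htop
    rw [htop, ENNReal.mul_top (ENNReal.ofReal_pos.2 (hwpos (k, τ))).ne'] at hτ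
    simp at hτ
  have hest : normS α ε s (-1 / 2) (conv U N) ≤ ENNReal.ofReal (D ^ (1 / 2 : ℝ)) *
      (normS α ε s b U * normW β ε l (1 / 2) N + normS α ε s (1 / 2) U * normW β ε l b N) := by
    rw [conv_congr_ae hUU' hNN']
    refine (weightedNorm_le_of_convAbs hU' hN' hw fun k τ => ?_).trans hmain
    refine (ofReal_mul_norm _ (hwpos (k, τ)).le _).le.trans ?_
    gcongr
    exact enorm_conv_le _ _ _ _
  refine ⟨fun k => ?_, ⟨fun k => ?_, ?_⟩, hest⟩
  · filter_upwards [hae k] with τ hτ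
    rwa [← convAbs_congr_ae hUU' hNN'] at hτ
  · rw [conv_congr_ae hUU' hNN']
    exact aestronglyMeasurable_conv hU' hN' (hae k)
  · exact hest.trans_lt (ENNReal.mul_lt_top ENNReal.ofReal_lt_top hfin)

/-- For `s ≥ 0` the space `X^{s,1/2}_S` lies in `L²`. -/
lemma lintegral_enorm_sq_lt_top {α ε s : ℝ} (hs : 0 ≤ s) {F : ℤ → ℝ → ℂ}
    (hF : ∀ k, Measurable (F k)) (h : normS α ε s (1 / 2) F < ∞) :
    ∫⁻ x : ℤ × ℝ, ‖F x.1 x.2‖ₑ ^ 2 ∂freqMeasure < ∞ := by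
  rw [normS, weightedNorm_eq (measurable_phaseS α ε) _ _ hF,
    ENNReal.rpow_lt_top_iff_of_pos (by norm_num)] at h
  refine lt_of_le_of_lt (lintegral_mono fun x => ?_) h
  gcongr
  rw [weighted, ← ofReal_norm]
  refine ENNReal.ofReal_le_ofReal (le_mul_of_one_le_left (norm_nonneg _) ?_)
  exact one_le_mul_of_one_le_of_one_le (Real.one_le_rpow (one_le_jap _) hs)
    (Real.one_le_rpow (one_le_jap _) (by norm_num))

/-- The estimate for `D^ρ (u v̄)` in the Bourgain spaces. -/
theorem exists_wave_conv_estimate {α β ε ρ s l b : ℝ} (hα : 0 < α) (hβ : 0 < β) (hε : 0 < ε)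
    (hρ : 0 < ρ) (hs : 0 ≤ s) (hl : l ≤ 2 * s + 1 - ρ) (hsl : -2 + ρ ≤ s - l)
    (hb : 1 / 6 < b) (hb' : b ≤ 1 / 2) :
    ∃ C : ℝ, 0 < C ∧ ∀ U V : ℤ → ℝ → ℂ, MemXS α ε s (1 / 2) U → MemXS α ε s (1 / 2) V →
      (∀ k, ∀ᵐ τ : ℝ, ConvAbs U (conjFT V) k τ) ∧
      MemXW β ε l (-1 / 2) (mulD ρ (conv U (conjFT V))) ∧
      normW β ε l (-1 / 2) (mulD ρ (conv U (conjFT V))) ≤ ENNReal.ofReal C *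
        (normS α ε s b U * normS α ε s (1 / 2) V + normS α ε s (1 / 2) U * normS α ε s b V) := by
  obtain ⟨D, hD, H⟩ := exists_wave_estimate hα hβ hε hρ hs hl hsl hb hb'
  refine ⟨D ^ (1 / 2 : ℝ), by positivity, fun U V ⟨hUm, hUn⟩ ⟨hVm, hVn⟩ => ?_⟩
  obtain ⟨U', hU', hUU'⟩ := exists_measurable_rep hUm
  obtain ⟨V', hV', hVV'⟩ := exists_measurable_rep hVm
  have hcV' : ∀ k, Measurable (conjFT V' k) := fun k => by
    have := hV' (-k)
    unfold conjFT; fun_prop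
  have hcVV' := conjFT_congr_ae hVV'
  have hfin : normS α ε s b U * normS α ε s (1 / 2) V +
      normS α ε s (1 / 2) U * normS α ε s b V < ∞ :=
    ENNReal.add_lt_top.2 ⟨ENNReal.mul_lt_top ((weightedNorm_mono_right _ _ hb' _).trans_lt hUn) hVn,
      ENNReal.mul_lt_top hUn ((weightedNorm_mono_right _ _ hb' _).trans_lt hVn)⟩
  have hw : Measurable fun x : ℤ × ℝ =>
      |(x.1 : ℝ)| ^ ρ * jap (x.1 : ℝ) ^ l * modW β ε x ^ (-1 / 2 : ℝ) := by
    fun_prop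
  have hw0 : ∀ x : ℤ × ℝ,
      0 ≤ |(x.1 : ℝ)| ^ ρ * jap (x.1 : ℝ) ^ l * modW β ε x ^ (-1 / 2 : ℝ) := fun x =>
    mul_nonneg (mul_nonneg (by positivity) (Real.rpow_nonneg (jap_pos _).le _))
      (Real.rpow_nonneg (modW_pos _ _ _).le _)
  have hmain : (∫⁻ x, (ENNReal.ofReal
      (|(x.1 : ℝ)| ^ ρ * jap (x.1 : ℝ) ^ l * modW β ε x ^ (-1 / 2 : ℝ)) *
      convNorm (fun x => U' x.1 x.2) (fun x => conjFT V' x.1 x.2) x) ^ 2 ∂freqMeasure) ^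
        (1 / 2 : ℝ) ≤
      ENNReal.ofReal (D ^ (1 / 2 : ℝ)) * (normS α ε s b U * normS α ε s (1 / 2) V +
        normS α ε s (1 / 2) U * normS α ε s b V) := by
    simp only [normS]
    rw [weightedNorm_congr_ae _ _ _ hUU', weightedNorm_congr_ae _ _ _ hUU',
      weightedNorm_congr_ae _ _ _ hVV', weightedNorm_congr_ae _ _ _ hVV',
      weightedNorm_eq (measurable_phaseS α ε) _ _ hU',
      weightedNorm_eq (measurable_phaseS α ε) _ _ hU',
      weightedNorm_eq (measurable_phaseS α ε) _ _ hV',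
      weightedNorm_eq (measurable_phaseS α ε) _ _ hV']
    refine le_trans ?_ (ennreal_sqrt_mul_le D hD.le _ _ _ _)
    gcongr
    exact H _ _ (measurable_uncurry hU') (measurable_uncurry hV')
  have hUn' : normS α ε s (1 / 2) U' < ∞ := by rwa [normS, ← weightedNorm_congr_ae _ _ _ hUU']
  have hVn' : normS α ε s (1 / 2) V' < ∞ := by rwa [normS, ← weightedNorm_congr_ae _ _ _ hVV']
  have hconv : ∀ k τ, convAbs U' (conjFT V') k τ < ∞ := by
    intro k τ
    have h1 : Measurable fun y : ℤ × ℝ => conjFT V' ((k, τ) - y).1 ((k, τ) - y).2 :=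
      (measurable_uncurry hcV').comp (by fun_prop : Measurable fun y : ℤ × ℝ => (k, τ) - y)
    have h2 := sq_lintegral_mul_le (μ := freqMeasure) (measurable_uncurry hU').enorm h1.enorm
    rw [lintegral_sub_left_eq_self (fun y : ℤ × ℝ => ‖conjFT V' y.1 y.2‖ₑ ^ 2) (k, τ)] at h2
    have h3 : ∫⁻ y : ℤ × ℝ, ‖conjFT V' y.1 y.2‖ₑ ^ 2 ∂freqMeasure =
        ∫⁻ y : ℤ × ℝ, ‖V' y.1 y.2‖ₑ ^ 2 ∂freqMeasure := by
      rw [← lintegral_neg_eq_self (fun y : ℤ × ℝ => ‖V' y.1 y.2‖ₑ ^ 2)]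
      simp [conjFT]
    rw [h3] at h2
    have h4 := h2.trans_lt (ENNReal.mul_lt_top
      (lintegral_enorm_sq_lt_top hs hU' hUn') (lintegral_enorm_sq_lt_top hs hV' hVn'))
    rw [convAbs_eq_convNorm hU' hcV' (k, τ)]
    exact (ENNReal.pow_lt_top_iff.1 h4).resolve_right two_ne_zero
  have hest : normW β ε l (-1 / 2) (mulD ρ (conv U (conjFT V))) ≤ ENNReal.ofReal (D ^ (1 / 2 : ℝ)) *
      (normS α ε s b U * normS α ε s (1 / 2) V + normS α ε s (1 / 2) U * normS α ε s b V) := by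
    rw [conv_congr_ae hUU' hcVV']
    refine (weightedNorm_le_of_convAbs hU' hcV' hw fun k τ => ?_).trans hmain
    have h1 : jap (k : ℝ) ^ l * jap (phaseW β ε k τ) ^ (-1 / 2 : ℝ) *
        ‖mulD ρ (conv U' (conjFT V')) k τ‖ =
        |((k, τ).1 : ℝ)| ^ ρ * jap ((k, τ).1 : ℝ) ^ l * modW β ε (k, τ) ^ (-1 / 2 : ℝ) *
          ‖conv U' (conjFT V') k τ‖ := by
      rw [mulD, norm_mul, Complex.norm_real, Real.norm_of_nonneg (by positivity), modW]
      ring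
    rw [h1, ofReal_mul_norm _ (hw0 (k, τ))]
    gcongr
    exact enorm_conv_le _ _ _ _
  refine ⟨fun k => .of_forall fun τ => ?_, ⟨fun k => ?_, ?_⟩, hest⟩
  · rw [ConvAbs, ← convAbs, convAbs_congr_ae hUU' hcVV']
    exact hconv k τ
  · rw [conv_congr_ae hUU' hcVV']
    exact (aestronglyMeasurable_conv hU' hcV' (.of_forall (hconv k))).const_mul _
  · exact hest.trans_lt (ENNReal.mul_lt_top ENNReal.ofReal_lt_top hfin)

/-! ### The Fourier transform of test functions -/

/-- The measure `dx dt` on a fundamental domain of `𝕋 × ℝ`. -/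
noncomputable abbrev stripMeasure : Measure (ℝ × ℝ) :=
  (volume.restrict (Set.Ioc 0 (2 * Real.pi))).prod volume

/-- The character `(x, t) ↦ e^{-i(kx + τt)}`. -/
noncomputable def character (k : ℤ) (τ : ℝ) (z : ℝ × ℝ) : ℂ :=
  Complex.exp (-Complex.I * ((k : ℂ) * (z.1 : ℂ) + (τ : ℂ) * (z.2 : ℂ)))

@[fun_prop]
lemma continuous_character (k : ℤ) (τ : ℝ) : Continuous (character k τ) := by
  unfold character; fun_prop

lemma norm_character (k : ℤ) (τ : ℝ) (z : ℝ × ℝ) : ‖character k τ z‖ = 1 := by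
  have : -Complex.I * ((k : ℂ) * (z.1 : ℂ) + (τ : ℂ) * (z.2 : ℂ)) =
      ((-(k * z.1 + τ * z.2) : ℝ) : ℂ) * Complex.I := by push_cast; ring
  rw [character, this, Complex.norm_exp_ofReal_mul_I]

lemma hasDerivAt_cexp_mul_I (a : ℝ) (c : ℂ) (x : ℝ) :
    HasDerivAt (fun y : ℝ => Complex.exp (-Complex.I * ((a : ℂ) * (y : ℂ) + c)))
      (-Complex.I * a * Complex.exp (-Complex.I * ((a : ℂ) * (x : ℂ) + c))) x := by
  have h : HasDerivAt (fun y : ℝ => -Complex.I * ((a : ℂ) * (y : ℂ) + c)) (-Complex.I * a) x := by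
    have := (((hasDerivAt_id x).ofReal_comp.const_mul (a : ℂ)).add_const c).const_mul (-Complex.I)
    simpa using this
  convert h.cexp using 1
  ring

namespace IsTest

variable {u v : ℝ × ℝ → ℂ}

lemma continuous (hu : IsTest u) : Continuous u := hu.smooth.continuous

lemma mul (hu : IsTest u) (hv : IsTest v) : IsTest fun z => u z * v z where
  smooth := hu.smooth.mul hv.smooth
  periodic x t := by rw [hu.periodic, hv.periodic]
  support := by
    obtain ⟨R, hR⟩ := hu.support
    exact ⟨R, fun x t h => by rw [hR x t h, zero_mul]⟩

lemma star (hu : IsTest u) : IsTest fun z => conj (u z) where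
  smooth := Complex.conjCLE.contDiff.comp hu.smooth
  periodic x t := by rw [hu.periodic]
  support := by
    obtain ⟨R, hR⟩ := hu.support
    exact ⟨R, fun x t h => by rw [hR x t h, map_zero]⟩

lemma fderiv_apply (hu : IsTest u) (w : ℝ × ℝ) : IsTest fun z => fderiv ℝ u z w where
  smooth := (hu.smooth.fderiv_right (m := ((⊤ : ℕ∞) : WithTop ℕ∞)) (by simp)).clm_apply
    contDiff_const
  periodic x t := by
    have h : (fun z : ℝ × ℝ => u (z + (2 * Real.pi, 0))) = u := by
      funext ⟨x, t⟩
      simpa using hu.periodic x t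
    have h2 := fderiv_comp_add_right (𝕜 := ℝ) (f := u) (x := (x, t)) (2 * Real.pi, (0 : ℝ))
    rw [h] at h2
    simp only [h2, Prod.mk_add_mk, add_zero]
  support := by
    obtain ⟨R, hR⟩ := hu.support
    refine ⟨R, fun x t h => ?_⟩
    have ho : IsOpen {z : ℝ × ℝ | R < |z.2|} := isOpen_lt continuous_const (by fun_prop)
    have he : u =ᶠ[nhds (x, t)] fun _ => 0 := by
      filter_upwards [ho.mem_nhds h] with z hz
      exact hR z.1 z.2 hz
    rw [he.fderiv_eq]
    simp

lemma integrable_mul (hu : IsTest u) {g : ℝ × ℝ → ℂ} (hg : Continuous g) :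
    Integrable (fun z => u z * g z) stripMeasure := by
  obtain ⟨R, hR⟩ := hu.support
  have hc : Continuous fun z => u z * g z := hu.continuous.mul hg
  have h1 : IntegrableOn (fun z => u z * g z) (Set.Icc 0 (2 * Real.pi) ×ˢ Set.Icc (-R) R) :=
    hc.continuousOn.integrableOn_compact (isCompact_Icc.prod isCompact_Icc)
  have h2 : IntegrableOn (fun z => u z * g z) (Set.Ioc 0 (2 * Real.pi) ×ˢ Set.univ) := by
    refine h1.of_forall_sdiff_eq_zero (measurableSet_Ioc.prod .univ) fun z hz => ?_
    have : R < |z.2| := by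
      by_contra hle
      exact hz.2 ⟨Set.Ioc_subset_Icc_self hz.1.1, abs_le.1 (not_lt.1 hle)⟩
    rw [hR z.1 z.2 this, zero_mul]
  rw [IntegrableOn, Measure.volume_eq_prod, ← Measure.prod_restrict, Measure.restrict_univ] at h2
  exact h2

lemma integrable (hu : IsTest u) : Integrable u stripMeasure := by
  simpa using hu.integrable_mul (continuous_const (y := (1 : ℂ)))

lemma integrable_section (hu : IsTest u) (x : ℝ) {g : ℝ → ℂ} (hg : Continuous g) :
    Integrable fun t => u (x, t) * g t := by
  obtain ⟨R, hR⟩ := hu.support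
  have hc : Continuous fun t => u (x, t) * g t :=
    (hu.continuous.comp (by fun_prop : Continuous fun t : ℝ => (x, t))).mul hg
  refine hc.integrable_of_hasCompactSupport
    (HasCompactSupport.intro (isCompact_Icc (a := -R) (b := R)) fun t ht => ?_)
  rw [hR x t (not_le.1 fun h => ht (abs_le.1 h)), zero_mul]

lemma hasDerivAt_fst (hu : IsTest u) (x t : ℝ) :
    HasDerivAt (fun y => u (y, t)) (fderiv ℝ u (x, t) (1, 0)) x := by
  have h := (hu.smooth.differentiable (by simp)).differentiableAt (x := (x, t)) |>.hasFDerivAt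
  exact h.comp_hasDerivAt x ((hasDerivAt_id x).prodMk (hasDerivAt_const x t))

lemma hasDerivAt_snd (hu : IsTest u) (x t : ℝ) :
    HasDerivAt (fun y => u (x, y)) (fderiv ℝ u (x, t) (0, 1)) t := by
  have h := (hu.smooth.differentiable (by simp)).differentiableAt (x := (x, t)) |>.hasFDerivAt
  exact h.comp_hasDerivAt t ((hasDerivAt_const t x).prodMk (hasDerivAt_id t))

lemma ft_eq_integral (hu : IsTest u) (k : ℤ) (τ : ℝ) :
    ft u k τ = (1 / (4 * (Real.pi : ℂ) ^ 2)) * ∫ z, u z * character k τ z ∂stripMeasure := by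
  rw [ft, integral_prod_symm _ (hu.integrable_mul (continuous_character k τ))]
  congr 1
  refine integral_congr_ae (.of_forall fun t => ?_)
  simp only []
  rw [intervalIntegral.integral_of_le (by positivity)]
  rfl

lemma ft_fderiv_fst (hu : IsTest u) (k : ℤ) (τ : ℝ) :
    ft (fun z => fderiv ℝ u z (1, 0)) k τ = Complex.I * k * ft u k τ := by
  have h : ∀ t : ℝ, ∫ x in (0 : ℝ)..(2 * Real.pi), fderiv ℝ u (x, t) (1, 0) *
      Complex.exp (-Complex.I * ((k : ℂ) * (x : ℂ) + (τ : ℂ) * (t : ℂ))) =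
      Complex.I * k * ∫ x in (0 : ℝ)..(2 * Real.pi), u (x, t) *
        Complex.exp (-Complex.I * ((k : ℂ) * (x : ℂ) + (τ : ℂ) * (t : ℂ))) := by
    intro t
    have hv := fun x : ℝ => hasDerivAt_cexp_mul_I (k : ℝ) ((τ : ℂ) * (t : ℂ)) x
    have hcu : Continuous fun x : ℝ => fderiv ℝ u (x, t) (1, 0) :=
      (hu.fderiv_apply (1, 0)).continuous.comp (by fun_prop : Continuous fun x : ℝ => (x, t))
    have hp := intervalIntegral.integral_mul_deriv_eq_deriv_mul (a := 0) (b := 2 * Real.pi)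
      (fun x _ => hu.hasDerivAt_fst x t) (fun x _ => hv x) (hcu.intervalIntegrable _ _)
      ((by fun_prop : Continuous fun x : ℝ => -Complex.I * ((k : ℝ) : ℂ) *
        Complex.exp (-Complex.I * (((k : ℝ) : ℂ) * (x : ℂ) + (τ : ℂ) * (t : ℂ)))).intervalIntegrable
          _ _)
    have hper : u (2 * Real.pi, t) = u (0, t) := by simpa using hu.periodic 0 t
    have hexp : Complex.exp
          (-Complex.I * (((k : ℝ) : ℂ) * ((2 * Real.pi : ℝ) : ℂ) + (τ : ℂ) * (t : ℂ))) =
        Complex.exp (-Complex.I * (((k : ℝ) : ℂ) * ((0 : ℝ) : ℂ) + (τ : ℂ) * (t : ℂ))) := by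
      rw [Complex.exp_eq_exp_iff_exists_int]
      exact ⟨-k, by push_cast; ring⟩
    rw [hper, hexp, sub_self, zero_sub] at hp
    rw [← intervalIntegral.integral_const_mul]
    have hp' := neg_eq_iff_eq_neg.2 hp
    push_cast at hp'
    rw [← hp', ← intervalIntegral.integral_neg]
    congr 1
    funext x
    ring
  simp only [ft]
  simp_rw [h]
  rw [integral_const_mul]
  ring

lemma ft_fderiv_snd (hu : IsTest u) (k : ℤ) (τ : ℝ) :
    ft (fun z => fderiv ℝ u z (0, 1)) k τ = Complex.I * τ * ft u k τ := by
  rw [hu.ft_eq_integral, (hu.fderiv_apply (0, 1)).ft_eq_integral,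
    integral_prod _ (hu.integrable_mul (continuous_character k τ)),
    integral_prod _ ((hu.fderiv_apply (0, 1)).integrable_mul (continuous_character k τ)),
    mul_left_comm, ← integral_const_mul (Complex.I * τ)]
  congr 1
  refine integral_congr_ae (.of_forall fun x => ?_)
  have hv := fun t : ℝ => hasDerivAt_cexp_mul_I τ ((k : ℂ) * (x : ℂ)) t
  simp only [character, add_comm ((k : ℂ) * (x : ℂ))]
  have hp := integral_mul_deriv_eq_deriv_mul_of_integrable
    (fun t _ => hu.hasDerivAt_snd x t) (fun t _ => hv t)
    (hu.integrable_section x (by fun_prop)) ((hu.fderiv_apply (0, 1)).integrable_section x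
      (by fun_prop)) (hu.integrable_section x (by fun_prop))
  have hp' := neg_eq_iff_eq_neg.2 hp
  rw [← hp', ← integral_neg, ← integral_const_mul]
  refine integral_congr_ae (.of_forall fun t => ?_)
  simp only []
  ring

/-- The Fourier transform of a test function decays faster than any polynomial. -/
lemma exists_ft_decay (p q : ℕ) : ∀ {u : ℝ × ℝ → ℂ}, IsTest u →
    ∃ C : ℝ, 0 ≤ C ∧ ∀ (k : ℤ) (τ : ℝ), jap (k : ℝ) ^ p * jap τ ^ q * ‖ft u k τ‖ ≤ C := by
  induction p with
  | zero =>
    induction q with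
    | zero =>
      intro u hu
      refine ⟨‖(1 / (4 * (Real.pi : ℂ) ^ 2))‖ * ∫ z, ‖u z‖ ∂stripMeasure,
        mul_nonneg (norm_nonneg _) (integral_nonneg fun z => norm_nonneg _), fun k τ => ?_⟩
      rw [pow_zero, pow_zero, one_mul, one_mul, hu.ft_eq_integral, norm_mul]
      refine mul_le_mul_of_nonneg_left ((norm_integral_le_integral_norm _).trans_eq ?_)
        (norm_nonneg _)
      simp_rw [norm_mul, norm_character, mul_one]
    | succ q ih =>
      intro u hu
      obtain ⟨C₁, hC₁, H₁⟩ := ih hu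
      obtain ⟨C₂, hC₂, H₂⟩ := ih (hu.fderiv_apply (0, 1))
      refine ⟨C₁ + C₂, add_nonneg hC₁ hC₂, fun k τ => ?_⟩
      have h1 := H₁ k τ
      have h2 := H₂ k τ
      rw [hu.ft_fderiv_snd, norm_mul, norm_mul, Complex.norm_I, one_mul, Complex.norm_real,
        Real.norm_eq_abs] at h2
      rw [pow_zero, one_mul] at h1 h2 ⊢
      have hX : 0 ≤ jap τ ^ q * ‖ft u k τ‖ :=
        mul_nonneg (pow_nonneg (jap_pos _).le _) (norm_nonneg _)
      calc jap τ ^ (q + 1) * ‖ft u k τ‖ = jap τ * (jap τ ^ q * ‖ft u k τ‖) := by ring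
        _ ≤ (1 + |τ|) * (jap τ ^ q * ‖ft u k τ‖) :=
          mul_le_mul_of_nonneg_right (jap_le_one_add_abs τ) hX
        _ = jap τ ^ q * ‖ft u k τ‖ + jap τ ^ q * (|τ| * ‖ft u k τ‖) := by ring
        _ ≤ _ := add_le_add h1 h2
  | succ p ih =>
    intro u hu
    obtain ⟨C₁, hC₁, H₁⟩ := ih hu
    obtain ⟨C₂, hC₂, H₂⟩ := ih (hu.fderiv_apply (1, 0))
    refine ⟨C₁ + C₂, add_nonneg hC₁ hC₂, fun k τ => ?_⟩
    have h1 := H₁ k τ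
    have h2 := H₂ k τ
    rw [hu.ft_fderiv_fst, norm_mul, norm_mul, Complex.norm_I, one_mul, Complex.norm_intCast] at h2
    have hX : 0 ≤ jap (k : ℝ) ^ p * jap τ ^ q * ‖ft u k τ‖ :=
      mul_nonneg (mul_nonneg (pow_nonneg (jap_pos _).le _) (pow_nonneg (jap_pos _).le _))
        (norm_nonneg _)
    calc jap (k : ℝ) ^ (p + 1) * jap τ ^ q * ‖ft u k τ‖
        = jap (k : ℝ) * (jap (k : ℝ) ^ p * jap τ ^ q * ‖ft u k τ‖) := by ring
      _ ≤ (1 + |(k : ℝ)|) * (jap (k : ℝ) ^ p * jap τ ^ q * ‖ft u k τ‖) :=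
        mul_le_mul_of_nonneg_right (jap_le_one_add_abs _) hX
      _ = jap (k : ℝ) ^ p * jap τ ^ q * ‖ft u k τ‖ +
          jap (k : ℝ) ^ p * jap τ ^ q * (|(k : ℝ)| * ‖ft u k τ‖) := by ring
      _ ≤ _ := add_le_add h1 h2

end IsTest

/-! ### Fourier inversion and products of test functions -/

lemma character_mul (k k' : ℤ) (τ τ' : ℝ) (z : ℝ × ℝ) :
    character k τ z * character k' τ' z = character (k + k') (τ + τ') z := by
  simp only [character]
  rw [← Complex.exp_add]
  congr 1
  push_cast
  ring

lemma integral_freqMeasure {f : ℤ × ℝ → ℂ} (hf : Integrable f freqMeasure) :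
    ∫ p, f p ∂freqMeasure = ∑' k : ℤ, ∫ τ : ℝ, f (k, τ) := by
  rw [integral_prod _ hf, integral_countable hf.integral_prod_left]
  simp

lemma integrable_jap_weight :
    Integrable (fun p : ℤ × ℝ => jap (p.1 : ℝ) ^ (-2 : ℝ) * jap p.2 ^ (-2 : ℝ)) freqMeasure := by
  refine Integrable.mul_prod (f := fun k : ℤ => jap (k : ℝ) ^ (-2 : ℝ)) ?_
    (integrable_jap_rpow one_lt_two)
  rw [integrable_count_iff]
  exact (summable_jap_rpow one_lt_two).norm

namespace IsTest

variable {u v : ℝ × ℝ → ℂ}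

lemma continuous_ft (hu : IsTest u) (k : ℤ) : Continuous (ft u k) := by
  have h : ft u k = fun τ => (1 / (4 * (Real.pi : ℂ) ^ 2)) *
      ∫ z, u z * character k τ z ∂stripMeasure := by
    funext τ; exact hu.ft_eq_integral k τ
  rw [h]
  refine continuous_const.mul (continuous_of_dominated (bound := fun z => ‖u z‖)
    (fun τ => (hu.integrable_mul (continuous_character k τ)).aestronglyMeasurable)
    (fun τ => .of_forall fun z => by rw [norm_mul, norm_character, mul_one])
    hu.integrable.norm (.of_forall fun z => ?_))
  unfold character
  fun_prop

lemma measurable_ft (hu : IsTest u) : Measurable fun p : ℤ × ℝ => ft u p.1 p.2 :=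
  measurable_uncurry fun k => (hu.continuous_ft k).measurable

lemma integrable_ft (hu : IsTest u) : Integrable (fun p : ℤ × ℝ => ft u p.1 p.2) freqMeasure := by
  obtain ⟨C, hC, H⟩ := exists_ft_decay 2 2 hu
  refine (integrable_jap_weight.const_mul C).mono' hu.measurable_ft.aestronglyMeasurable
    (.of_forall fun p => ?_)
  have h1 : 0 < jap (p.1 : ℝ) ^ 2 := pow_pos (jap_pos _) 2
  have h2 : 0 < jap p.2 ^ 2 := pow_pos (jap_pos _) 2
  have h := H p.1 p.2
  rw [Real.rpow_neg (jap_pos _).le, Real.rpow_neg (jap_pos _).le, Real.rpow_two, Real.rpow_two,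
    ← mul_inv, ← div_eq_mul_inv, le_div_iff₀ (mul_pos h1 h2)]
  linarith

/-- The weights are of polynomial growth, so test functions lie in all the Bourgain spaces. -/
lemma weightedNorm_ft_lt_top (hu : IsTest u) {φ : ℤ → ℝ → ℝ}
    (hφm : Measurable fun x : ℤ × ℝ => φ x.1 x.2) {A : ℝ}
    (hφ : ∀ k τ, jap (φ k τ) ≤ A * (jap (k : ℝ) ^ 4 * jap τ)) (s : ℝ) :
    weightedNorm φ s (1 / 2) (ft u) < ∞ := by
  obtain ⟨m, hm⟩ := exists_nat_ge s
  obtain ⟨C, hC, H⟩ := exists_ft_decay (m + 5) 2 hu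
  rw [weightedNorm_eq hφm _ _ fun k => (hu.continuous_ft k).measurable]
  refine ENNReal.rpow_lt_top_of_nonneg (by norm_num) (ne_of_lt ?_)
  refine lt_of_le_of_lt (lintegral_mono fun p => ?_)
    (integrable_jap_weight.const_mul ((A * C) ^ 2)).lintegral_lt_top
  rw [weighted, ← ENNReal.ofReal_pow (mul_nonneg (mul_nonneg (Real.rpow_nonneg (jap_pos _).le _)
    (Real.rpow_nonneg (jap_pos _).le _)) (norm_nonneg _))]
  refine ENNReal.ofReal_le_ofReal ?_
  have hk := jap_pos (p.1 : ℝ)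
  have ht := jap_pos p.2
  have h1 : jap (p.1 : ℝ) ^ s ≤ jap (p.1 : ℝ) ^ m := by
    rw [← Real.rpow_natCast]
    exact Real.rpow_le_rpow_of_exponent_le (one_le_jap _) hm
  have h2 : jap (φ p.1 p.2) ^ (1 / 2 : ℝ) ≤ A * (jap (p.1 : ℝ) ^ 4 * jap p.2) := by
    refine le_trans ?_ (hφ p.1 p.2)
    conv_rhs => rw [← Real.rpow_one (jap (φ p.1 p.2))]
    exact Real.rpow_le_rpow_of_exponent_le (one_le_jap _) (by norm_num)
  have hA : 0 ≤ A := by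
    have := (jap_pos _).le.trans (hφ 0 0)
    simpa using this
  have h3 : jap (p.1 : ℝ) ^ s * jap (φ p.1 p.2) ^ (1 / 2 : ℝ) * ‖ft u p.1 p.2‖ ≤
      A * C * ((jap (p.1 : ℝ))⁻¹ * (jap p.2)⁻¹) := by
    rw [← mul_inv, ← div_eq_mul_inv, le_div_iff₀ (mul_pos hk ht)]
    calc jap (p.1 : ℝ) ^ s * jap (φ p.1 p.2) ^ (1 / 2 : ℝ) * ‖ft u p.1 p.2‖ *
          (jap (p.1 : ℝ) * jap p.2)
        ≤ jap (p.1 : ℝ) ^ m * (A * (jap (p.1 : ℝ) ^ 4 * jap p.2)) * ‖ft u p.1 p.2‖ *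
          (jap (p.1 : ℝ) * jap p.2) := by
          have := Real.rpow_nonneg (jap_pos (φ p.1 p.2)).le (1 / 2)
          gcongr
      _ = A * (jap (p.1 : ℝ) ^ (m + 5) * jap p.2 ^ 2 * ‖ft u p.1 p.2‖) := by ring
      _ ≤ A * C := mul_le_mul_of_nonneg_left (H _ _) hA
  calc _ ≤ (A * C * ((jap (p.1 : ℝ))⁻¹ * (jap p.2)⁻¹)) ^ 2 := by
        refine pow_le_pow_left₀ ?_ h3 2
        exact mul_nonneg (mul_nonneg (Real.rpow_nonneg hk.le _) (Real.rpow_nonneg (jap_pos _).le _))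
          (norm_nonneg _)
    _ = _ := by
        rw [Real.rpow_neg hk.le, Real.rpow_neg ht.le, Real.rpow_two, Real.rpow_two]
        ring

lemma memXS_ft (hu : IsTest u) {α ε : ℝ} (hα : 0 < α) (s : ℝ) :
    MemXS α ε s (1 / 2) (ft u) := by
  refine ⟨fun k => (hu.continuous_ft k).aestronglyMeasurable,
    hu.weightedNorm_ft_lt_top (measurable_phaseS α ε) (A := 2 + α + ε ^ 2) (fun k τ => ?_) s⟩
  have hk := one_le_jap (k : ℝ)
  have ht := one_le_jap τ
  have hk2 : (k : ℝ) ^ 2 ≤ jap (k : ℝ) ^ 2 := by rw [jap_sq]; linarith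
  have hk4 : (k : ℝ) ^ 4 ≤ jap (k : ℝ) ^ 4 := by
    have := pow_le_pow_left₀ (sq_nonneg (k : ℝ)) hk2 2
    rwa [← pow_mul, ← pow_mul] at this
  have hj24 : jap (k : ℝ) ^ 2 ≤ jap (k : ℝ) ^ 4 := pow_le_pow_right₀ hk (by norm_num)
  have hj4 : 1 ≤ jap (k : ℝ) ^ 4 := one_le_pow₀ hk
  have hX : jap (k : ℝ) ^ 4 ≤ jap (k : ℝ) ^ 4 * jap τ := le_mul_of_one_le_right (by linarith) ht
  have hY : jap τ ≤ jap (k : ℝ) ^ 4 * jap τ := le_mul_of_one_le_left (by linarith) hj4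
  have habs : |phaseS α ε k τ| ≤ |τ| + α * (k : ℝ) ^ 2 + ε ^ 2 * (k : ℝ) ^ 4 := by
    unfold phaseS
    refine (abs_add_le _ _).trans (add_le_add ((abs_add_le _ _).trans ?_) ?_)
    · rw [abs_of_nonneg (show 0 ≤ α * (k : ℝ) ^ 2 by positivity)]
    · rw [abs_of_nonneg (by positivity)]
  have h1 : α * (k : ℝ) ^ 2 ≤ α * (jap (k : ℝ) ^ 4 * jap τ) :=
    mul_le_mul_of_nonneg_left (hk2.trans (hj24.trans hX)) hα.le
  have h2 : ε ^ 2 * (k : ℝ) ^ 4 ≤ ε ^ 2 * (jap (k : ℝ) ^ 4 * jap τ) :=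
    mul_le_mul_of_nonneg_left (hk4.trans hX) (sq_nonneg ε)
  have h3 := jap_le_one_add_abs (phaseS α ε k τ)
  have h4 := abs_le_jap τ
  linarith

lemma memXW_ft (hu : IsTest u) {β ε : ℝ} (hβ : 0 < β) (hε : 0 < ε) (l : ℝ) :
    MemXW β ε l (1 / 2) (ft u) := by
  refine ⟨fun k => (hu.continuous_ft k).aestronglyMeasurable,
    hu.weightedNorm_ft_lt_top (measurable_phaseW β ε)
      (A := 2 + β * ε + β / (2 * ε)) (fun k τ => ?_) l⟩
  have hk := one_le_jap (k : ℝ)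
  have ht := one_le_jap τ
  have hk2 : (k : ℝ) ^ 2 ≤ jap (k : ℝ) ^ 2 := by rw [jap_sq]; linarith
  have hj24 : jap (k : ℝ) ^ 2 ≤ jap (k : ℝ) ^ 4 := pow_le_pow_right₀ hk (by norm_num)
  have hj4 : 1 ≤ jap (k : ℝ) ^ 4 := one_le_pow₀ hk
  have hX : jap (k : ℝ) ^ 4 ≤ jap (k : ℝ) ^ 4 * jap τ := le_mul_of_one_le_right (by linarith) ht
  have hY : jap τ ≤ jap (k : ℝ) ^ 4 * jap τ := le_mul_of_one_le_left (by linarith) hj4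
  have hω := waveFreq_le hβ hε (k : ℝ)
  have hω0 : 0 ≤ β * |(k : ℝ)| * jap (ε * (k : ℝ)) :=
    mul_nonneg (by positivity) (jap_pos _).le
  have habs : |phaseW β ε k τ| ≤ |τ| + β * |(k : ℝ)| * jap (ε * (k : ℝ)) := by
    unfold phaseW
    refine (abs_sub _ _).trans ?_
    rw [abs_abs, abs_of_nonneg hω0]
  have h1 : β * ε * (k : ℝ) ^ 2 ≤ β * ε * (jap (k : ℝ) ^ 4 * jap τ) :=
    mul_le_mul_of_nonneg_left (hk2.trans (hj24.trans hX)) (by positivity)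
  have h2 : β / (2 * ε) * 1 ≤ β / (2 * ε) * (jap (k : ℝ) ^ 4 * jap τ) :=
    mul_le_mul_of_nonneg_left (hj4.trans hX) (by positivity)
  have h3 := jap_le_one_add_abs (phaseW β ε k τ)
  have h4 := abs_le_jap τ
  linarith

/-- The inversion formula in time: the Fourier coefficients in `x` at time `t` are recovered from
the space-time Fourier transform. -/
lemma integral_ft_mul_cexp (hu : IsTest u) (k : ℤ) (t : ℝ) :
    2 * Real.pi * ∫ τ : ℝ, ft u k τ * Complex.exp (Complex.I * (τ * t)) =
      ∫ x in (0 : ℝ)..(2 * Real.pi), u (x, t) * Complex.exp (-Complex.I * (k * x)) := by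
  obtain ⟨R, hR⟩ := hu.support
  have hcu := hu.continuous
  set a : ℝ → ℂ := fun t =>
    ∫ x in (0 : ℝ)..(2 * Real.pi), u (x, t) * Complex.exp (-Complex.I * (k * x)) with ha
  have hac : Continuous a :=
    intervalIntegral.continuous_parametric_intervalIntegral_of_continuous' (by fun_prop) _ _
  have hai : Integrable a := by
    refine hac.integrable_of_hasCompactSupport
      (HasCompactSupport.intro (isCompact_Icc (a := -R) (b := R)) fun t ht => ?_)
    have h0 : ∀ x, u (x, t) = 0 := fun x => hR x t (not_le.1 fun h => ht (abs_le.1 h))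
    simp [ha, h0]
  have hpi : (2 * Real.pi : ℝ) ≠ 0 := by positivity
  have hft : ∀ τ : ℝ, ft u k τ = (1 / (4 * (Real.pi : ℂ) ^ 2)) *
      ∫ t : ℝ, Complex.exp (-Complex.I * (τ * t)) * a t := by
    intro τ
    rw [ft]
    congr 1
    refine integral_congr_ae (.of_forall fun t => ?_)
    simp only [ha]
    rw [← intervalIntegral.integral_const_mul]
    congr 1
    funext x
    rw [mul_left_comm, ← Complex.exp_add]
    congr 2
    ring
  have hF : FourierTransform.fourier a = fun ξ : ℝ =>
      4 * (Real.pi : ℂ) ^ 2 * ft u k (2 * Real.pi * ξ) := by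
    funext ξ
    rw [Real.fourier_real_eq_integral_exp_smul, hft, ← mul_assoc, mul_one_div_cancel (by
      have := Real.pi_ne_zero; simp [this]), one_mul]
    congr 1
    funext s
    rw [smul_eq_mul]
    congr 2
    push_cast
    ring
  have hki : Integrable (ft u k) := by
    obtain ⟨C, hC, H⟩ := exists_ft_decay 0 2 hu
    refine ((integrable_jap_rpow one_lt_two).const_mul C).mono'
      (hu.continuous_ft k).aestronglyMeasurable (.of_forall fun τ => ?_)
    have h2 : 0 < jap τ ^ 2 := pow_pos (jap_pos _) 2
    have h := H k τ
    rw [pow_zero, one_mul] at h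
    rw [Real.rpow_neg (jap_pos _).le, Real.rpow_two, ← div_eq_mul_inv, le_div_iff₀ h2]
    linarith
  have hFi : Integrable (FourierTransform.fourier a) := by
    rw [hF]
    exact (hki.comp_mul_left' hpi).const_mul _
  have hinv := congrFun (hac.fourierInv_fourier_eq hai hFi) t
  rw [Real.fourierInv_eq', hF] at hinv
  have hcv := Measure.integral_comp_mul_left
    (fun τ : ℝ => ft u k τ * Complex.exp (Complex.I * (τ * t))) (2 * Real.pi)
  rw [show ∫ x in (0 : ℝ)..(2 * Real.pi), u (x, t) * Complex.exp (-Complex.I * (k * x)) = a t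
    from rfl, ← hinv]
  have h1 : ∫ v : ℝ, Complex.exp (((2 * Real.pi * inner ℝ v t : ℝ) : ℂ) * Complex.I) •
      (4 * (Real.pi : ℂ) ^ 2 * ft u k (2 * Real.pi * v)) = 4 * (Real.pi : ℂ) ^ 2 *
      ∫ v : ℝ, ft u k (2 * Real.pi * v) *
        Complex.exp (Complex.I * (((2 * Real.pi * v : ℝ) : ℂ) * t)) := by
    rw [← integral_const_mul]
    congr 1
    funext v
    rw [smul_eq_mul, mul_comm, mul_assoc]
    congr 3
    simp only [RCLike.inner_apply, conj_trivial]
    push_cast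
    ring
  rw [h1, hcv, abs_of_pos (by positivity), Complex.real_smul]
  generalize (∫ τ : ℝ, ft u k τ * Complex.exp (Complex.I * (τ * t))) = J
  have := Real.pi_ne_zero
  push_cast
  field_simp
  ring

/-- The Fourier inversion formula for test functions. -/
lemma integral_ft_mul_character (hu : IsTest u) (z : ℝ × ℝ) :
    ∫ p, ft u p.1 p.2 * character (-p.1) (-p.2) z ∂freqMeasure = u z := by
  obtain ⟨x, t⟩ := z
  have hmeas : Measurable fun p : ℤ × ℝ => character (-p.1) (-p.2) (x, t) :=
    measurable_of_forall_section fun k => by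
      unfold character; fun_prop
  have hint : Integrable (fun p : ℤ × ℝ => ft u p.1 p.2 * character (-p.1) (-p.2) (x, t))
      freqMeasure :=
    hu.integrable_ft.mul_bdd (c := 1) hmeas.aestronglyMeasurable
      (.of_forall fun p => (norm_character _ _ _).le)
  rw [integral_freqMeasure hint]
  have hsec : ∀ k : ℤ, ∫ τ : ℝ, ft u k τ * character (-k) (-τ) (x, t) =
      (∫ τ : ℝ, ft u k τ * Complex.exp (Complex.I * (τ * t))) *
        Complex.exp (Complex.I * (k * x)) := by
    intro k
    rw [← integral_mul_const]
    congr 1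
    funext τ
    rw [mul_assoc, ← Complex.exp_add, character]
    congr 2
    push_cast
    ring
  have hsum : Summable fun k : ℤ => ∫ τ : ℝ, ft u k τ * character (-k) (-τ) (x, t) := by
    have := hint.integral_prod_left
    rw [integrable_count_iff] at this
    exact this.of_norm
  have : Fact (0 < 2 * Real.pi) := ⟨by positivity⟩
  have hper : Function.Periodic (fun y => u (y, t)) (2 * Real.pi) := fun y => hu.periodic y t
  have hcont : Continuous (hper.lift : AddCircle (2 * Real.pi) → ℂ) :=
    continuous_coinduced_dom.2
      (hu.continuous.comp (by fun_prop : Continuous fun y : ℝ => (y, t)))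
  set f : C(AddCircle (2 * Real.pi), ℂ) := ⟨hper.lift, hcont⟩ with hf
  have hfc : ∀ y : ℝ, f (y : AddCircle (2 * Real.pi)) = u (y, t) := fun y => rfl
  have hpi : (Real.pi : ℂ) ≠ 0 := by simp [Real.pi_ne_zero]
  have hcoef : ∀ k : ℤ, fourierCoeff f k =
      ∫ τ : ℝ, ft u k τ * Complex.exp (Complex.I * (τ * t)) := by
    intro k
    rw [fourierCoeff_eq_intervalIntegral f k 0, zero_add]
    have h := hu.integral_ft_mul_cexp k t
    have h2 : ∫ y in (0 : ℝ)..(2 * Real.pi), (fourier (-k) : AddCircle (2 * Real.pi) → ℂ)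
        (y : AddCircle (2 * Real.pi)) • f (y : AddCircle (2 * Real.pi)) =
        ∫ y in (0 : ℝ)..(2 * Real.pi), u (y, t) * Complex.exp (-Complex.I * (k * y)) := by
      congr 1
      funext y
      rw [hfc, fourier_coe_apply, smul_eq_mul, mul_comm]
      congr 2
      push_cast
      field_simp
    rw [h2, ← h, Complex.real_smul]
    generalize (∫ τ : ℝ, ft u k τ * Complex.exp (Complex.I * (τ * t))) = J
    push_cast
    field_simp
  have hfour : ∀ k : ℤ, fourierCoeff f k • (fourier k : AddCircle (2 * Real.pi) → ℂ)
      (x : AddCircle (2 * Real.pi)) = ∫ τ : ℝ, ft u k τ * character (-k) (-τ) (x, t) := by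
    intro k
    rw [hsec, hcoef, fourier_coe_apply, smul_eq_mul]
    congr 2
    push_cast
    field_simp
  have hcs : Summable (fourierCoeff f) := by
    rw [← summable_norm_iff] at hsum ⊢
    refine hsum.congr fun k => ?_
    rw [← hfour, norm_smul, fourier_apply, Circle.norm_coe, mul_one]
  have hsumm := (has_pointwise_sum_fourier_series_of_summable hcs
    (x : AddCircle (2 * Real.pi))).tsum_eq
  simp_rw [hfour] at hsumm
  rw [hsumm, hfc]

/-- The Fourier transform of a product is the convolution of the Fourier transforms. -/
lemma ft_mul (hu : IsTest u) (hv : IsTest v) :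
    ft (fun z => u z * v z) = conv (ft u) (ft v) := by
  funext k τ
  have hchar : ∀ (p : ℤ × ℝ) (z : ℝ × ℝ), character (-p.1) (-p.2) z * character k τ z =
      character (k - p.1) (τ - p.2) z := fun p z => by
    rw [character_mul, neg_add_eq_sub, neg_add_eq_sub]
  have hint : Integrable (Function.uncurry fun (z : ℝ × ℝ) (p : ℤ × ℝ) =>
      v z * ft u p.1 p.2 * character (k - p.1) (τ - p.2) z) (stripMeasure.prod freqMeasure) := by
    refine (hv.integrable.mul_prod hu.integrable_ft).mul_bdd (c := 1) ?_
      (.of_forall fun p => (norm_character _ _ _).le)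
    refine Measurable.aestronglyMeasurable ?_
    unfold character
    fun_prop
  have hbdd : Integrable (fun p : ℤ × ℝ => ft u p.1 p.2 * ft v (k - p.1) (τ - p.2))
      freqMeasure := by
    obtain ⟨C, hC, H⟩ := exists_ft_decay 0 0 hv
    refine hu.integrable_ft.mul_bdd (c := C) ?_ (.of_forall fun p => by
      simpa using H (k - p.1) (τ - p.2))
    exact (hv.measurable_ft.comp (by fun_prop : Measurable fun p : ℤ × ℝ =>
      (k - p.1, τ - p.2))).aestronglyMeasurable
  rw [(hu.mul hv).ft_eq_integral]
  calc (1 / (4 * (Real.pi : ℂ) ^ 2)) * ∫ z, u z * v z * character k τ z ∂stripMeasure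
      = (1 / (4 * (Real.pi : ℂ) ^ 2)) * ∫ z, ∫ p, v z * ft u p.1 p.2 *
          character (k - p.1) (τ - p.2) z ∂freqMeasure ∂stripMeasure := by
        congr 1
        refine integral_congr_ae (.of_forall fun z => ?_)
        simp only []
        rw [← hu.integral_ft_mul_character z, mul_assoc, ← integral_mul_const]
        refine integral_congr_ae (.of_forall fun p => ?_)
        simp only []
        rw [← hchar]
        ring
    _ = ∫ p, (1 / (4 * (Real.pi : ℂ) ^ 2)) * ∫ z, v z * ft u p.1 p.2 *
          character (k - p.1) (τ - p.2) z ∂stripMeasure ∂freqMeasure := by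
        rw [integral_integral_swap hint, integral_const_mul]
    _ = ∫ p, ft u p.1 p.2 * ft v (k - p.1) (τ - p.2) ∂freqMeasure := by
        refine integral_congr_ae (.of_forall fun p => ?_)
        simp only []
        rw [hv.ft_eq_integral, mul_left_comm (ft u p.1 p.2), ← integral_const_mul (ft u p.1 p.2)]
        congr 2
        funext z
        ring
    _ = conv (ft u) (ft v) k τ := integral_freqMeasure hbdd

lemma ft_conj (hv : IsTest v) : ft (fun z => conj (v z)) = conjFT (ft v) := by
  funext k τ
  rw [conjFT, hv.ft_eq_integral, hv.star.ft_eq_integral, map_mul, ← integral_conj]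
  congr 1
  · simp [map_ofNat (starRingEnd ℂ) 4]
  · congr 1
    funext z
    rw [map_mul, character, character, ← Complex.exp_conj]
    congr 2
    simp only [map_mul, map_neg, map_add, Complex.conj_I, Complex.conj_ofReal, map_intCast]
    push_cast
    ring

end IsTest

end QZS

theorem propositionp (α β ε ρ s l b : ℝ) (hα : 0 < α) (hβ : 0 < β) (hε : 0 < ε)
    (hρ0 : 0 < ρ) (hρ1 : ρ ≤ 1) (hs : 0 ≤ s) (hl : -1 ≤ l) (hl' : l ≤ 2 * s + 1 - ρ)
    (hsl : -2 + ρ ≤ s - l) (hsl' : s - l ≤ 2) (hb : 1 / 6 < b) (hb' : b ≤ 1 / 2) :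
    ∃ C : ℝ, 0 < C ∧
      -- smooth compactly supported functions on `𝕋 × ℝ`, with pointwise products
      (∀ u n : ℝ × ℝ → ℂ, QZS.IsTest u → QZS.IsTest n →
        QZS.normS α ε s (-1 / 2) (QZS.ft (fun z => u z * n z)) ≤
          ENNReal.ofReal C *
            (QZS.normS α ε s b (QZS.ft u) * QZS.normW β ε l (1 / 2) (QZS.ft n) +
              QZS.normS α ε s (1 / 2) (QZS.ft u) * QZS.normW β ε l b (QZS.ft n))) ∧
      (∀ u v : ℝ × ℝ → ℂ, QZS.IsTest u → QZS.IsTest v →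
        QZS.normW β ε l (-1 / 2) (QZS.mulD ρ (QZS.ft (fun z => u z * conj (v z)))) ≤
          ENNReal.ofReal C *
            (QZS.normS α ε s b (QZS.ft u) * QZS.normS α ε s (1 / 2) (QZS.ft v) +
              QZS.normS α ε s (1 / 2) (QZS.ft u) * QZS.normS α ε s b (QZS.ft v))) ∧
      -- all elements of the Bourgain spaces, given by their space-time Fourier transforms
      (∀ U N : ℤ → ℝ → ℂ, QZS.MemXS α ε s (1 / 2) U → QZS.MemXW β ε l (1 / 2) N →
        (∀ k, ∀ᵐ τ : ℝ, QZS.ConvAbs U N k τ) ∧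
        QZS.MemXS α ε s (-1 / 2) (QZS.conv U N) ∧
        QZS.normS α ε s (-1 / 2) (QZS.conv U N) ≤
          ENNReal.ofReal C *
            (QZS.normS α ε s b U * QZS.normW β ε l (1 / 2) N +
              QZS.normS α ε s (1 / 2) U * QZS.normW β ε l b N)) ∧
      (∀ U V : ℤ → ℝ → ℂ, QZS.MemXS α ε s (1 / 2) U → QZS.MemXS α ε s (1 / 2) V →
        (∀ k, ∀ᵐ τ : ℝ, QZS.ConvAbs U (QZS.conjFT V) k τ) ∧
        QZS.MemXW β ε l (-1 / 2) (QZS.mulD ρ (QZS.conv U (QZS.conjFT V))) ∧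
        QZS.normW β ε l (-1 / 2) (QZS.mulD ρ (QZS.conv U (QZS.conjFT V))) ≤
          ENNReal.ofReal C *
            (QZS.normS α ε s b U * QZS.normS α ε s (1 / 2) V +
              QZS.normS α ε s (1 / 2) U * QZS.normS α ε s b V)) := by
  obtain ⟨C₁, hC₁, H₁⟩ := QZS.exists_schrodinger_conv_estimate hα hβ hε hs hl hsl' hb hb'
  obtain ⟨C₂, hC₂, H₂⟩ := QZS.exists_wave_conv_estimate hα hβ hε hρ0 hs hl' hsl hb hb'
  have h₁ : ENNReal.ofReal C₁ ≤ ENNReal.ofReal (C₁ + C₂) := ENNReal.ofReal_le_ofReal (by linarith)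
  have h₂ : ENNReal.ofReal C₂ ≤ ENNReal.ofReal (C₁ + C₂) := ENNReal.ofReal_le_ofReal (by linarith)
  refine ⟨C₁ + C₂, by positivity, fun u n hu hn => ?_, fun u v hu hv => ?_,
    fun U N hU hN => ?_, fun U V hU hV => ?_⟩
  · rw [hu.ft_mul hn]
    exact (H₁ _ _ (hu.memXS_ft hα s) (hn.memXW_ft hβ hε l)).2.2.trans (by gcongr)
  · rw [hu.ft_mul hv.star, hv.ft_conj]
    exact (H₂ _ _ (hu.memXS_ft hα s) (hv.memXS_ft hα s)).2.2.trans (by gcongr)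
  · obtain ⟨h1, h2, h3⟩ := H₁ U N hU hN
    exact ⟨h1, h2, h3.trans (by gcongr)⟩
  · obtain ⟨h1, h2, h3⟩ := H₂ U V hU hV
    exact ⟨h1, h2, h3.trans (by gcongr)⟩
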